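/- Fix a link distance $d>0$, ranges $R_t,R_r>0$, a wavelength $w>0$, an antenna spacing $d_0\ge 0$ and numbers of antennas $N_t,N_r\ge 1$. For $N\in\{N_t,N_r\}$ let $G_N(\phi)=\cos^2\!\big(\tfrac{\pi N d_0}{2w}\phi\big)$ if $N d_0|\phi|\le w$ and $G_N(\phi)=0$ otherwise (so $G_N\equiv 1$ if $d_0=0$). The exclusion region of a transmitter $y\in\mathbb R^2$ with receiver $x\in\mathbb R^2$ is $$S(y,x)=\{z:\|z-y\|\le R_t\sqrt{G_{N_t}(\angle(z-y,x-y))}\}\cup\{z:\|z-x\|\le R_r\sqrt{G_{N_r}(\angle(z-x,y-x))}\},$$ where $\angle(u,v)\in[0,\pi]$ is the angle between $u$ and $v$. Let $V_o$ be the area of $S(o,(d,0))$, where $o$ is the origin. For $\lambda_p>0$, let $\Phi_{\rm PPP}=\{y_i\}$ be a homogeneous Poisson point process of intensity $\lambda_p$ on $\mathbb R^2$. Let $\theta_i$ be i.i.d. uniform on $[0,2\pi]$ and independent of the $y_i$, and let $x_i=y_i+d(\cos\theta_i,\sin\theta_i)$ be the receiver of $y_i$. In Type II thinning let, moreover, $t_i$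 be i.i.d. time marks, uniform on $[0,1]$ and independent of the $y_i$ and $\theta_i$. Under Type I thinning $y_i$ is active (retained) if no other $y_j$ lies in $S(y_i,x_i)$; under Type II thinning $y_i$ is active if no other $y_j$ with $t_j<t_i$ lies in $S(y_i,x_i)$. The resulting set $\Phi$ of active transmitters is the generalized RTS/CTS hard-core process (G-HCP) of the respective type. Let $p$ be the Palm probability, with respect to $\Phi_{\rm PPP}$, that the transmitter at $o$ is retained, and let $\lambda_b=\lambda_p\,p$ be the node intensity. Then $0<V_o<\infty$, the mean number of points of $\Phi$ in every Borel set $B\subseteq\mathbb R^2$ is $\lambda_b$ times the area of $B$, and the following hold. 1. Type I: $p=e^{-\lambda_pV_o}$ and $\lambda_b=\lambda_p e^{-\lambda_pV_o}$. As a function of $\lambda_p\in(0,\infty)$, $\lambda_b$ is strictly increasing for $\lambda_p\le 1/V_o$ and strictly decreasing for $\lambda_p\ge 1/V_o$; it has a unique maximum, at $\lambda_p=1/V_o$, with value $\tfrac1{V_o}e^{-1}$. 2. Type II: $p=\int_0^1e^{-\lambda_p tV_o}\,dt$ and $$\lambda_b=\lambda_p\int_0^1e^{-\lambda_p tV_o}\,dt=\frac{1-e^{-\lambda_pV_o}}{V_o}.$$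 As a function of $\lambda_p\in(0,\infty)$, $\lambda_b$ is strictly increasing, and $\lambda_b\to 1/V_o$ as $\lambda_p\to\infty$. -/

import Mathlib

open MeasureTheory ProbabilityTheory Filter Topology
open scoped ENNReal NNReal

noncomputable section

/-- The Euclidean plane, with its Euclidean norm and Lebesgue measure. -/
abbrev Plane : Type := EuclideanSpace ℝ (Fin 2)

/-! ### Antenna gains and exclusion regions -/

/-- The parameters of the RTS/CTS exclusion regions: link distance `d`, maximum RTS and CTS ranges
`Rt` and `Rr`, wavelength `wl`, antenna spacing `d₀` and numbers of antennas `Nt` and `Nr`.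
The value `d₀ = 0` is the omnidirectional case. -/
structure RTSCTSConfig where
  d : ℝ
  Rt : ℝ
  Rr : ℝ
  wl : ℝ
  d₀ : ℝ
  Nt : ℕ
  Nr : ℕ
  d_pos : 0 < d
  Rt_pos : 0 < Rt
  Rr_pos : 0 < Rr
  wl_pos : 0 < wl
  d₀_nonneg : 0 ≤ d₀
  Nt_pos : 0 < Nt
  Nr_pos : 0 < Nr

/-- The cosine antenna gain `cos² (π N d₀ φ / (2 wl))` for `|φ| ≤ wl / (d₀ N)`, and `0` otherwise.
The condition is written without the division, so that for `d₀ = 0` the gain is `1` in every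
direction. -/
def antennaGain (N : ℕ) (d₀ wl φ : ℝ) : ℝ :=
  if |φ| * (d₀ * N) ≤ wl then Real.cos (Real.pi * N * d₀ / (2 * wl) * φ) ^ 2 else 0

/-- The points `z` with `‖z - a‖ ≤ R √(G(φ))`, where `φ ∈ [0, π]` is the angle between `z - a` and
`b - a`: the region cleaned by a node at `a` of range `R` whose beam points towards `b`. -/
def cleanedRegion (R : ℝ) (G : ℝ → ℝ) (a b : Plane) : Set Plane :=
  {z | ‖z - a‖ ≤ R * √(G (InnerProductGeometry.angle (z - a) (b - a)))}

namespace RTSCTSConfig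

/-- The RTS exclusion region of the transmitter `y` with receiver `x`. -/
def rtsRegion (c : RTSCTSConfig) (y x : Plane) : Set Plane :=
  cleanedRegion c.Rt (antennaGain c.Nt c.d₀ c.wl) y x

/-- The CTS exclusion region of the receiver `x` with transmitter `y`. -/
def ctsRegion (c : RTSCTSConfig) (y x : Plane) : Set Plane :=
  cleanedRegion c.Rr (antennaGain c.Nr c.d₀ c.wl) x y

/-- The exclusion region `S(y, x)` of the transceiver pair `(y, x)`. -/
def exclusionRegion (c : RTSCTSConfig) (y x : Plane) : Set Plane :=
  c.rtsRegion y x ∪ c.ctsRegion y x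

/-- The receiver at distance `d` from the transmitter `y`, in the direction `θ`. -/
def receiver (c : RTSCTSConfig) (y : Plane) (θ : ℝ) : Plane :=
  y + c.d • !₂[Real.cos θ, Real.sin θ]

/-- `V_o`: the area of the exclusion region of the typical pair, with transmitter at the origin
and receiver at `(d, 0)`. -/
def Vo (c : RTSCTSConfig) : ℝ :=
  volume.real (c.exclusionRegion 0 !₂[c.d, 0])

/-! ### The two thinning rules, on a configuration of marked points -/

/-- Type I: the other transmitters in the exclusion region of the pair `p = (y, θ)`. -/
def neighborsI (c : RTSCTSConfig) (ψ : Set (Plane × ℝ)) (p : Plane × ℝ) : Set (Plane × ℝ) :=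
  {q ∈ ψ \ {p} | q.1 ∈ c.exclusionRegion p.1 (c.receiver p.1 p.2)}

/-- Type I: the active transmitters, those whose pair has no neighbor. -/
def activeI (c : RTSCTSConfig) (ψ : Set (Plane × ℝ)) : Set Plane :=
  Prod.fst '' {p ∈ ψ | (c.neighborsI ψ p).encard = 0}

/-- Type II: the other transmitters that are in the exclusion region of `p = (y, θ, t)` and have a
time mark smaller than `t`. -/
def neighborsII (c : RTSCTSConfig) (ψ : Set (Plane × ℝ × ℝ)) (p : Plane × ℝ × ℝ) :
    Set (Plane × ℝ × ℝ) :=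
  {q ∈ ψ \ {p} | q.1 ∈ c.exclusionRegion p.1 (c.receiver p.1 p.2.1) ∧ q.2.2 < p.2.2}

/-- Type II: the active transmitters, those whose pair has no neighbor. -/
def activeII (c : RTSCTSConfig) (ψ : Set (Plane × ℝ × ℝ)) : Set Plane :=
  Prod.fst '' {p ∈ ψ | (c.neighborsII ψ p).encard = 0}

end RTSCTSConfig

/-! ### Poisson point processes and their markings -/

/-- The random set `Φ` is a homogeneous Poisson point process of intensity `l` on the plane: the
number of points in a Borel set of finite area is Poisson distributed with mean `l` times the area,
and the numbers of points in disjoint Borel sets are independent. -/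
structure IsHomogeneousPPP {Ω : Type*} [MeasurableSpace Ω] (P : Measure Ω) (l : ℝ)
    (Φ : Ω → Set Plane) : Prop where
  count_law : ∀ B : Set Plane, MeasurableSet B → volume B ≠ ∞ → ∀ k : ℕ,
    P {ω | (Φ ω ∩ B).encard = k} =
      ENNReal.ofReal (Real.exp (-(l * volume.real B)) * (l * volume.real B) ^ k / k.factorial)
  indep : ∀ (n : ℕ) (B : Fin n → Set Plane), (∀ i, MeasurableSet (B i)) →
    Pairwise (fun i j => Disjoint (B i) (B j)) →
    iIndepFun (fun i ω => (Φ ω ∩ B i).encard) P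

/-- A Poisson bipolar process of intensity `l`: the transmitters `y i`, enumerated without
repetition, form a homogeneous Poisson point process of intensity `l`, and the orientations `θ i` of
their receivers are i.i.d. uniform on `[0, 2π]` and independent of the transmitters. -/
structure BipolarProcess {Ω : Type*} [MeasurableSpace Ω] (P : Measure Ω) (l : ℝ) where
  y : ℕ → Ω → Plane
  θ : ℕ → Ω → ℝ
  measurable_y : ∀ i, Measurable (y i)
  measurable_θ : ∀ i, Measurable (θ i)
  injective_y : ∀ᵐ ω ∂P, Function.Injective fun i => y i ω
  isPPP : IsHomogeneousPPP P l fun ω => Set.range fun i => y i ω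
  uniform_θ : ∀ i, pdf.IsUniform (θ i) (Set.Icc 0 (2 * Real.pi)) P
  iIndep_θ : iIndepFun θ P
  indep_y_θ : IndepFun (fun ω i => y i ω) (fun ω i => θ i ω) P

/-- A Poisson bipolar process with time marks `t i` that are i.i.d. uniform on `[0, 1]` and
independent of the transmitters and of the orientations. -/
structure TimedBipolarProcess {Ω : Type*} [MeasurableSpace Ω] (P : Measure Ω) (l : ℝ)
    extends BipolarProcess P l where
  t : ℕ → Ω → ℝ
  measurable_t : ∀ i, Measurable (t i)
  uniform_t : ∀ i, pdf.IsUniform (t i) (Set.Icc 0 1) P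
  iIndep_t : iIndepFun t P
  indep_yθ_t : IndepFun (fun ω => (fun i => y i ω, fun i => θ i ω)) (fun ω i => t i ω) P

/-- The random configuration of transmitters marked with orientations. -/
def BipolarProcess.config {Ω : Type*} [MeasurableSpace Ω] {P : Measure Ω} {l : ℝ}
    (X : BipolarProcess P l) (ω : Ω) : Set (Plane × ℝ) :=
  Set.range fun i => (X.y i ω, X.θ i ω)

/-- The random configuration of transmitters marked with orientations and time marks. -/
def TimedBipolarProcess.timedConfig {Ω : Type*} [MeasurableSpace Ω] {P : Measure Ω} {l : ℝ}
    (X : TimedBipolarProcess P l) (ω : Ω) : Set (Plane × ℝ × ℝ) :=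
  Set.range fun i => (X.y i ω, X.θ i ω, X.t i ω)

/-! ### Palm probability and intensity -/

/-- The translation by `v` of a configuration with marks in `K`. -/
def translateConfig {K : Type*} (v : Plane) (ψ : Set (Plane × K)) : Set (Plane × K) :=
  (fun p => (p.1 + v, p.2)) '' ψ

/-- The Palm probability of the event `A` for a stationary marked point process `Ψ` of intensity
`l`: the mean number of points in the unit square from which the configuration is seen to be in `A`,
divided by the mean number `l` of points in the unit square. -/
def palmProb {Ω K : Type*} [MeasurableSpace Ω] (P : Measure Ω) (l : ℝ) (Ψ : Ω → Set (Plane × K))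
    (A : Set (Set (Plane × K))) : ℝ≥0∞ :=
  (∫⁻ ω, (({p ∈ Ψ ω | (∀ k, p.1 k ∈ Set.Ico (0 : ℝ) 1) ∧
    translateConfig (-p.1) (Ψ ω) ∈ A}.encard : ℕ∞) : ℝ≥0∞) ∂P) / ENNReal.ofReal l

/-- The random set `Φ` has intensity `b`: the mean number of its points in a Borel set is `b` times
the area of the set. -/
def HasIntensity {Ω : Type*} [MeasurableSpace Ω] (P : Measure Ω) (Φ : Ω → Set Plane) (b : ℝ) :
    Prop :=
  ∀ B : Set Plane, MeasurableSet B →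
    ∫⁻ ω, (((Φ ω ∩ B).encard : ℕ∞) : ℝ≥0∞) ∂P = ENNReal.ofReal b * volume B

/-- The Palm probability that the transmitter at the origin is retained by Type I thinning. -/
def BipolarProcess.retentionProbI {Ω : Type*} [MeasurableSpace Ω] {P : Measure Ω} {l : ℝ}
    (X : BipolarProcess P l) (c : RTSCTSConfig) : ℝ≥0∞ :=
  palmProb P l X.config {ψ | 0 ∈ c.activeI ψ}

/-- The Palm probability that the transmitter at the origin is retained by Type II thinning. -/
def TimedBipolarProcess.retentionProbII {Ω : Type*} [MeasurableSpace Ω] {P : Measure Ω} {l : ℝ}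
    (X : TimedBipolarProcess P l) (c : RTSCTSConfig) : ℝ≥0∞ :=
  palmProb P l X.timedConfig {ψ | 0 ∈ c.activeII ψ}

/-- The node intensity `λ_b` of the active transmitters under Type I thinning: the intensity of all
transmitters times the Palm probability of retention. -/
def BipolarProcess.nodeIntensityI {Ω : Type*} [MeasurableSpace Ω] {P : Measure Ω} {l : ℝ}
    (X : BipolarProcess P l) (c : RTSCTSConfig) : ℝ :=
  l * (X.retentionProbI c).toReal

/-- The node intensity `λ_b` of the active transmitters under Type II thinning: the intensity of all
transmitters times the Palm probability of retention. -/
def TimedBipolarProcess.nodeIntensityII {Ω : Type*} [MeasurableSpace Ω] {P : Measure Ω} {l : ℝ}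
    (X : TimedBipolarProcess P l) (c : RTSCTSConfig) : ℝ :=
  l * (X.retentionProbII c).toReal

end

/-! Both the Palm probability and the intensity come down to the sum over `i` of the probabilities
that `y i` lies in `B` and is retained. The reduced Mecke formula (`BipolarProcess.mecke`) says
that, seen from a typical point, the other points still form the original Poisson process. For a
bounded function `f` of the number of neighbors the sum is therefore `l * volume B * E f(N)`, with
`N` Poisson of mean `a = l * V_o`. Type I takes for `f` the indicator of `0` and gives `exp (-a)`.
In Type II a point with `n` neighbors carries the smallest of `n + 1` i.i.d. uniform marks with
probability `1 / (n + 1)`, and `E 1/(N+1) = (1 - exp (-a)) / a`, which is the integral of `exp (-a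
t)` over `[0, 1]`.

The Mecke formula is derived from Poisson counts and independence alone. For a fixed set it follows
from independence and from the identity `E[N g(N - 1)] = a E[g(N)]` (`mecke_of_disjoint`,
`mecke_of_subset`). For a compact set attached to the point, the point is replaced by a countably
valued approximation and the set by a thickening; local finiteness makes the error vanish in the
limit (`IsPPPEnumeration.mecke`). Random orientations are integrated out last: the area of the
region does not depend on them (`volume_regionAt`). -/

theorem ProbabilityTheory.IndepFun.lintegral_comp_eq {Ω α β : Type*} [MeasurableSpace Ω]
    [MeasurableSpace α] [MeasurableSpace β] {P : Measure Ω} [IsProbabilityMeasure P]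
    {X : Ω → α} {Y : Ω → β} (h : IndepFun X Y P) (hX : Measurable X) (hY : Measurable Y)
    {G : α → β → ℝ≥0∞} (hG : Measurable (Function.uncurry G)) :
    ∫⁻ ω, G (X ω) (Y ω) ∂P = ∫⁻ ω, ∫⁻ ω', G (X ω) (Y ω') ∂P ∂P := by
  have hmap := h.map_prod_eq_prod_map_map hX.aemeasurable hY.aemeasurable
  have := Measure.isProbabilityMeasure_map (μ := P) hX.aemeasurable
  have := Measure.isProbabilityMeasure_map (μ := P) hY.aemeasurable
  calc ∫⁻ ω, G (X ω) (Y ω) ∂P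
      = ∫⁻ z, Function.uncurry G z ∂(P.map fun ω => (X ω, Y ω)) := by
        rw [lintegral_map hG (hX.prodMk hY)]; rfl
    _ = ∫⁻ x, ∫⁻ y, G x y ∂(P.map Y) ∂(P.map X) := by
        rw [hmap, lintegral_prod _ hG.aemeasurable]; rfl
    _ = ∫⁻ ω, ∫⁻ y, G (X ω) y ∂(P.map Y) ∂P := by
        exact lintegral_map (f := fun x => ∫⁻ y, G x y ∂(P.map Y)) hG.lintegral_prod_right' hX
    _ = _ := by
        refine lintegral_congr fun ω => ?_
        exact lintegral_map (f := fun y => G (X ω) y) (hG.comp measurable_prodMk_left) hY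

/-! ### Poisson distributed counts -/

/-- The extended natural number valued random variable `N` is Poisson distributed with mean `a`. -/
def IsPoissonCount {Ω : Type*} [MeasurableSpace Ω] (P : Measure Ω) (N : Ω → ℕ∞) (a : ℝ) : Prop :=
  ∀ k : ℕ, P {ω | N ω = k} = ENNReal.ofReal (Real.exp (-a) * a ^ k / k.factorial)

namespace IsPoissonCount

variable {Ω : Type*} [MeasurableSpace Ω] {P : Measure Ω} [IsProbabilityMeasure P]
  {N : Ω → ℕ∞} {a : ℝ}

/-- The Poisson weights already sum to one, so no mass is left for `⊤`. -/
theorem ae_ne_top (h : IsPoissonCount P N a) (hN : Measurable N) (ha : 0 ≤ a) :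
    ∀ᵐ ω ∂P, N ω ≠ ⊤ := by
  have hm : ∀ k : ℕ, MeasurableSet {ω | N ω = k} := fun k => hN (measurableSet_singleton _)
  have hset : {ω | N ω ≠ ⊤} = ⋃ k : ℕ, {ω | N ω = k} := by
    ext ω
    simp only [Set.mem_ofPred_eq, Set.mem_iUnion, ENat.ne_top_iff_exists]
    exact ⟨fun ⟨k, hk⟩ => ⟨k, hk.symm⟩, fun ⟨k, hk⟩ => ⟨k, hk.symm⟩⟩
  have hone : P {ω | N ω ≠ ⊤} = 1 := by
    rw [hset, measure_iUnion _ hm]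
    · have hs : HasSum (fun k : ℕ => Real.exp (-a) * a ^ k / k.factorial) 1 :=
        hasSum_one_poissonMeasure ⟨a, ha⟩
      simp_rw [h _]
      rw [← ENNReal.ofReal_tsum_of_nonneg (fun k => by positivity) hs.summable]
      rw [hs.tsum_eq, ENNReal.ofReal_one]
    · intro i j hij
      refine Set.disjoint_left.2 fun ω hi hj => hij ?_
      simp only [Set.mem_ofPred_eq] at hi hj
      exact_mod_cast hi.symm.trans hj
  have hmt : MeasurableSet {ω | N ω ≠ ⊤} := hN (measurableSet_singleton _).compl
  exact (prob_compl_eq_zero_iff hmt).2 hone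

theorem lintegral_comp (h : IsPoissonCount P N a) (hN : Measurable N) (ha : 0 ≤ a)
    (g : ℕ∞ → ℝ≥0∞) :
    ∫⁻ ω, g (N ω) ∂P
      = ∑' k : ℕ, ENNReal.ofReal (Real.exp (-a) * a ^ k / k.factorial) * g k := by
  have hm : ∀ k : ℕ, MeasurableSet {ω | N ω = k} := fun k => hN (measurableSet_singleton _)
  have h1 : ∫⁻ ω, g (N ω) ∂P
      = ∫⁻ ω, ∑' k : ℕ, Set.indicator {ω | N ω = k} (fun _ => g k) ω ∂P := by
    refine lintegral_congr_ae ?_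
    filter_upwards [h.ae_ne_top hN ha] with ω hω
    obtain ⟨n, hn⟩ := ENat.ne_top_iff_exists.1 hω
    rw [tsum_eq_single n]
    · simp [← hn]
    · intro k hk
      refine Set.indicator_of_notMem ?_ _
      simp only [Set.mem_ofPred_eq, ← hn]
      exact_mod_cast hk.symm
  rw [h1, lintegral_tsum fun k => (measurable_const.indicator (hm k)).aemeasurable]
  refine tsum_congr fun k => ?_
  rw [lintegral_indicator_const (hm k), h k, mul_comm]

/-- This is the size-bias identity that characterizes the Poisson law: `k + 1` times the weight at
`k + 1` is `a` times the weight at `k`. It carries the whole Mecke formula; `g = 1` gives the mean.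
-/
theorem lintegral_mul_comp_sub_one (h : IsPoissonCount P N a) (hN : Measurable N) (ha : 0 ≤ a)
    (g : ℕ∞ → ℝ≥0∞) :
    ∫⁻ ω, (N ω : ℝ≥0∞) * g (N ω - 1) ∂P = ENNReal.ofReal a * ∫⁻ ω, g (N ω) ∂P := by
  -- The term `k = 0` is killed by the factor `N`, so the truncated difference `0 - 1` plays no role
  -- and the sum can be shifted by one.
  rw [h.lintegral_comp hN ha g, h.lintegral_comp hN ha fun n => (n : ℝ≥0∞) * g (n - 1),
    tsum_eq_zero_add' ENNReal.summable, ← ENNReal.tsum_mul_left]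
  simp only [Nat.cast_zero, ENat.toENNReal_zero, zero_mul, mul_zero, zero_add]
  refine tsum_congr fun k => ?_
  have h1 : ((k + 1 : ℕ) : ℕ∞) - 1 = k := by
    rw [Nat.cast_add, Nat.cast_one, AddLECancellable.add_tsub_cancel_right]
    exact ENat.addLECancellable_of_ne_top (by simp)
  have h2 : (((k + 1 : ℕ) : ℕ∞) : ℝ≥0∞) = ENNReal.ofReal (k + 1 : ℝ) := by
    rw [ENat.toENNReal_coe, ← ENNReal.ofReal_natCast]; push_cast; rfl
  rw [h1, h2, ← mul_assoc, ← mul_assoc, ← ENNReal.ofReal_mul (by positivity),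
    ← ENNReal.ofReal_mul ha]
  congr 2
  rw [Nat.factorial_succ]
  push_cast
  field_simp
  ring

theorem lintegral_coe (h : IsPoissonCount P N a) (hN : Measurable N) (ha : 0 ≤ a) :
    ∫⁻ ω, (N ω : ℝ≥0∞) ∂P = ENNReal.ofReal a := by
  simpa using h.lintegral_mul_comp_sub_one hN ha fun _ => 1

end IsPoissonCount

/-! ### Enumerated Poisson processes and the Mecke formula -/

/-- The points `y i` enumerate a homogeneous Poisson point process of intensity `l` measurably and
almost surely without repetition. -/
structure IsPPPEnumeration {Ω : Type*} [MeasurableSpace Ω] (P : Measure Ω) (l : ℝ)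
    (y : ℕ → Ω → Plane) : Prop where
  measurable : ∀ i, Measurable (y i)
  injective : ∀ᵐ ω ∂P, Function.Injective fun i => y i ω
  isPPP : IsHomogeneousPPP P l fun ω => Set.range fun i => y i ω

/-- The number of indices of points in `D`. -/
noncomputable def indexCount {Ω : Type*} (y : ℕ → Ω → Plane) (D : Set Plane) (ω : Ω) : ℕ∞ :=
  {i | y i ω ∈ D}.encard

/-- The number of indices other than `i` of points in `D`. -/
noncomputable def otherCount {Ω : Type*} (y : ℕ → Ω → Plane) (i : ℕ) (D : Set Plane) (ω : Ω) : ℕ∞ :=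
  {j | j ≠ i ∧ y j ω ∈ D}.encard

theorem measurable_encard_of_measurableSet {α : Type*} [MeasurableSpace α] {p : ℕ → α → Prop}
    (h : ∀ j, MeasurableSet {a | p j a}) : Measurable fun a => {j | p j a}.encard :=
  measurable_encard.comp (measurable_set_iff.2 fun j => measurableSet_setOfPred.1 (h j))

theorem tsum_indicator_eq_encard {ι α : Type*} (x : ι → α) (B : Set α) :
    ∑' i, B.indicator (fun _ => (1 : ℝ≥0∞)) (x i) = ({i | x i ∈ B}.encard : ℝ≥0∞) := by
  rw [← ENNReal.tsum_set_one, tsum_subtype {i | x i ∈ B} fun _ => (1 : ℝ≥0∞)]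
  rfl

theorem indexCount_eq_add_diff {Ω : Type*} {y : ℕ → Ω → Plane} {B D : Set Plane} (hBD : B ⊆ D) (ω : Ω) :
    indexCount y D ω = indexCount y B ω + indexCount y (D \ B) ω := by
  rw [indexCount, indexCount, indexCount, ← Set.encard_union_eq]
  · congr 1
    ext j
    exact ⟨fun hj => (em (y j ω ∈ B)).imp id fun h => ⟨hj, h⟩,
      fun hj => hj.elim (fun h => hBD h) fun h => h.1⟩
  · exact Set.disjoint_left.2 fun j hj hj' => hj'.2 hj

namespace IsPPPEnumeration

variable {Ω : Type*} [MeasurableSpace Ω] {P : Measure Ω} {l : ℝ}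
  {y : ℕ → Ω → Plane}

theorem measurable_indexCount (h : IsPPPEnumeration P l y) {D : Set Plane}
    (hD : MeasurableSet D) : Measurable (indexCount y D) :=
  measurable_encard_of_measurableSet fun j => h.measurable j hD

theorem measurable_otherCount (h : IsPPPEnumeration P l y) (i : ℕ) {D : Set Plane}
    (hD : MeasurableSet D) : Measurable (otherCount y i D) :=
  measurable_encard_of_measurableSet fun j => (MeasurableSet.const _).inter (h.measurable j hD)

/-- The Poisson axioms count points of a random set, while the proof counts indices; almost sure
injectivity identifies the two. -/
theorem encard_range_inter (h : IsPPPEnumeration P l y) (D : Set Plane) :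
    (fun ω => ((Set.range fun i => y i ω) ∩ D).encard) =ᵐ[P] indexCount y D := by
  filter_upwards [h.injective] with ω hω
  rw [indexCount, ← hω.encard_image]
  congr 1
  ext z
  constructor
  · rintro ⟨⟨i, rfl⟩, hz⟩
    exact ⟨i, hz, rfl⟩
  · rintro ⟨i, hi, rfl⟩
    exact ⟨⟨i, rfl⟩, hi⟩

theorem isPoissonCount (h : IsPPPEnumeration P l y) {D : Set Plane} (hD : MeasurableSet D)
    (hv : volume D ≠ ∞) : IsPoissonCount P (indexCount y D) (l * volume.real D) := by
  intro k
  rw [← h.isPPP.count_law D hD hv k]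
  refine measure_congr ?_
  filter_upwards [h.encard_range_inter D] with ω hω
  exact propext (by
    change indexCount y D ω = k ↔ ((Set.range fun i => y i ω) ∩ D).encard = k
    rw [hω])

theorem indepFun_indexCount (h : IsPPPEnumeration P l y) {D E : Set Plane} (hD : MeasurableSet D)
    (hE : MeasurableSet E) (hDE : Disjoint D E) :
    IndepFun (indexCount y D) (indexCount y E) P := by
  have h1 := h.isPPP.indep 2 ![D, E] (by
    intro i; fin_cases i <;> assumption) (by
    intro i j hij
    fin_cases i <;> fin_cases j <;> first | exact absurd rfl hij | exact hDE | exact hDE.symm)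
  have h2 := h1.indepFun (i := 0) (j := 1) (by decide)
  exact h2.congr (h.encard_range_inter D) (h.encard_range_inter E)

variable [IsProbabilityMeasure P]

theorem ae_indexCount_ne_top (h : IsPPPEnumeration P l y) (hl : 0 ≤ l) {D : Set Plane}
    (hD : MeasurableSet D) (hv : volume D ≠ ∞) : ∀ᵐ ω ∂P, indexCount y D ω ≠ ⊤ :=
  (h.isPoissonCount hD hv).ae_ne_top (h.measurable_indexCount hD) (by positivity)

theorem lintegral_indexCount_congr (h : IsPPPEnumeration P l y) (hl : 0 ≤ l) {D E : Set Plane}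
    (hD : MeasurableSet D) (hE : MeasurableSet E) (hv : volume D ≠ ∞) (hDE : volume D = volume E)
    (f : ℕ∞ → ℝ≥0∞) : ∫⁻ ω, f (indexCount y D ω) ∂P = ∫⁻ ω, f (indexCount y E ω) ∂P := by
  rw [(h.isPoissonCount hD hv).lintegral_comp (h.measurable_indexCount hD) (by positivity),
    (h.isPoissonCount hE (hDE ▸ hv)).lintegral_comp (h.measurable_indexCount hE) (by positivity)]
  simp only [Measure.real, hDE]

/-- A point of `B` is never in `D`, so leaving out the index `i` changes nothing. The sum is the
product of the count in `B` with a function of the independent count in `D`. -/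
theorem mecke_of_disjoint (h : IsPPPEnumeration P l y) (hl : 0 ≤ l) {B D : Set Plane}
    (hB : MeasurableSet B) (hD : MeasurableSet D) (hv : volume B ≠ ∞) (hBD : Disjoint B D)
    (f : ℕ∞ → ℝ≥0∞) :
    ∫⁻ ω, ∑' i, B.indicator (fun _ => 1) (y i ω) * f (otherCount y i D ω) ∂P
      = ENNReal.ofReal (l * volume.real B) * ∫⁻ ω, f (indexCount y D ω) ∂P := by
  have key : ∀ ω, ∑' i, B.indicator (fun _ => 1) (y i ω) * f (otherCount y i D ω)
      = (indexCount y B ω : ℝ≥0∞) * f (indexCount y D ω) := by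
    intro ω
    rw [indexCount, ← tsum_indicator_eq_encard, ← ENNReal.tsum_mul_right]
    refine tsum_congr fun i => ?_
    by_cases hi : y i ω ∈ B
    · rw [otherCount, indexCount]
      congr 3
      ext j
      refine ⟨fun hj => hj.2, fun hj => ⟨?_, hj⟩⟩
      rintro rfl
      exact Set.disjoint_left.1 hBD hi hj
    · simp [hi]
  simp_rw [key]
  rw [(h.indepFun_indexCount hB hD hBD).lintegral_comp_eq (h.measurable_indexCount hB)
    (h.measurable_indexCount hD) (G := fun m k => (m : ℝ≥0∞) * f k) (Measurable.of_discrete)]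
  have h1 : ∀ ω, ∫⁻ ω', (indexCount y B ω : ℝ≥0∞) * f (indexCount y D ω') ∂P
      = (indexCount y B ω : ℝ≥0∞) * ∫⁻ ω', f (indexCount y D ω') ∂P := fun ω =>
    lintegral_const_mul _ (Measurable.of_discrete.comp (h.measurable_indexCount hD))
  simp_rw [h1]
  rw [lintegral_mul_const _ (f := fun ω => (indexCount y B ω : ℝ≥0∞))
    ((Measurable.of_discrete (f := ENat.toENNReal)).comp (h.measurable_indexCount hB)),
    (h.isPoissonCount hB hv).lintegral_coe (h.measurable_indexCount hB) (by positivity)]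

/-- Each point of `B` sees one point fewer in `B` and all those of `D \ B`. With the independent
count in `D \ B` held fixed, the size-bias identity absorbs the missing point; the two counts then
recombine into that of `D`. -/
theorem mecke_of_subset (h : IsPPPEnumeration P l y) (hl : 0 ≤ l) {B D : Set Plane}
    (hB : MeasurableSet B) (hD : MeasurableSet D) (hv : volume B ≠ ∞) (hBD : B ⊆ D)
    (f : ℕ∞ → ℝ≥0∞) :
    ∫⁻ ω, ∑' i, B.indicator (fun _ => 1) (y i ω) * f (otherCount y i D ω) ∂P
      = ENNReal.ofReal (l * volume.real B) * ∫⁻ ω, f (indexCount y D ω) ∂P := by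
  have key : ∀ ω, ∑' i, B.indicator (fun _ => 1) (y i ω) * f (otherCount y i D ω)
      = (indexCount y B ω : ℝ≥0∞) * f (indexCount y B ω - 1 + indexCount y (D \ B) ω) := by
    intro ω
    rw [indexCount, ← tsum_indicator_eq_encard, ← ENNReal.tsum_mul_right]
    refine tsum_congr fun i => ?_
    by_cases hi : y i ω ∈ B
    · congr 2
      have h1 : otherCount y i D ω = {j | j ≠ i ∧ y j ω ∈ B}.encard + indexCount y (D \ B) ω := by
        rw [otherCount, indexCount, ← Set.encard_union_eq]
        · congr 1
          ext j
          refine ⟨fun hj => (em (y j ω ∈ B)).imp (fun h => ⟨hj.1, h⟩) fun h => ⟨hj.2, h⟩,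
            fun hj => hj.elim (fun h => ⟨h.1, hBD h.2⟩) fun h => ⟨?_, h.1⟩⟩
          rintro rfl
          exact h.2 hi
        · exact Set.disjoint_left.2 fun j hj hj' => hj'.2 hj.2
      have h2 : {j | j ≠ i ∧ y j ω ∈ B} = {j | y j ω ∈ B} \ {i} := by
        ext j
        exact and_comm
      rw [h1, h2, Set.encard_sdiff_singleton_of_mem (show i ∈ {j | y j ω ∈ B} from hi)]
    · simp [hi]
  have hDB := hD.diff hB
  have hind := (h.indepFun_indexCount hB hDB Set.disjoint_sdiff_right).symm
  simp_rw [key]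
  rw [hind.lintegral_comp_eq (h.measurable_indexCount hDB)
    (h.measurable_indexCount hB) (G := fun k m => (m : ℝ≥0∞) * f (m - 1 + k))
    (Measurable.of_discrete)]
  have h1 : ∀ ω, ∫⁻ ω', (indexCount y B ω' : ℝ≥0∞) *
      f (indexCount y B ω' - 1 + indexCount y (D \ B) ω) ∂P
      = ENNReal.ofReal (l * volume.real B) *
        ∫⁻ ω', f (indexCount y B ω' + indexCount y (D \ B) ω) ∂P := fun ω =>
    (h.isPoissonCount hB hv).lintegral_mul_comp_sub_one (h.measurable_indexCount hB)
      (by positivity) fun n => f (n + indexCount y (D \ B) ω)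
  simp_rw [h1]
  have hG : Measurable (Function.uncurry fun k m : ℕ∞ => f (m + k)) := Measurable.of_discrete
  rw [lintegral_const_mul' _ _ ENNReal.ofReal_ne_top, ← hind.lintegral_comp_eq
    (h.measurable_indexCount hDB) (h.measurable_indexCount hB) hG]
  simp_rw [indexCount_eq_add_diff hBD]

/-- The Mecke formula for a fixed set. -/
theorem mecke_const (h : IsPPPEnumeration P l y) (hl : 0 ≤ l) {B D : Set Plane}
    (hB : MeasurableSet B) (hD : MeasurableSet D) (hv : volume B ≠ ∞) (f : ℕ∞ → ℝ≥0∞) :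
    ∫⁻ ω, ∑' i, B.indicator (fun _ => 1) (y i ω) * f (otherCount y i D ω) ∂P
      = ENNReal.ofReal l * volume B * ∫⁻ ω, f (indexCount y D ω) ∂P := by
  have hm : ∀ {C : Set Plane}, MeasurableSet C → ∀ i, Measurable fun ω =>
      C.indicator (fun _ => (1 : ℝ≥0∞)) (y i ω) * f (otherCount y i D ω) := fun hC i =>
    ((measurable_const.indicator hC).comp (h.measurable i)).mul
      (Measurable.of_discrete.comp (h.measurable_otherCount i hD))
  have hvi : volume (B ∩ D) ≠ ∞ := measure_ne_top_of_subset Set.inter_subset_left hv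
  have hvd : volume (B \ D) ≠ ∞ := measure_ne_top_of_subset Set.sdiff_subset hv
  -- `B` is cut into its parts inside and outside `D`, one for each of the two previous cases.
  have key : ∀ ω, ∑' i, B.indicator (fun _ => 1) (y i ω) * f (otherCount y i D ω)
      = (∑' i, (B ∩ D).indicator (fun _ => 1) (y i ω) * f (otherCount y i D ω)) +
        ∑' i, (B \ D).indicator (fun _ => 1) (y i ω) * f (otherCount y i D ω) := by
    intro ω
    rw [← ENNReal.tsum_add]
    refine tsum_congr fun i => ?_
    by_cases h1 : y i ω ∈ B <;> by_cases h2 : y i ω ∈ D <;> simp [h1, h2]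
  simp_rw [key]
  rw [lintegral_add_left (Measurable.tsum (hm (hB.inter hD))),
    h.mecke_of_subset hl (hB.inter hD) hD hvi Set.inter_subset_right,
    h.mecke_of_disjoint hl (hB.diff hD) hD hvd Set.disjoint_sdiff_left, ← add_mul,
    ← ENNReal.ofReal_add (by positivity) (by positivity), ← mul_add,
    measureReal_inter_add_sdiff hD hv, ENNReal.ofReal_mul hl, ofReal_measureReal hv]

end IsPPPEnumeration

/-! ### From fixed sets to sets that move with the point. -/

theorem exists_measurable_discretization {ε : ℝ} (hε : 0 < ε) :
    ∃ (q : ℕ → Plane) (n : Plane → ℕ), Measurable n ∧ ∀ x, dist (q (n x)) x ≤ ε := by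
  classical
  have hex : ∀ x : Plane, ∃ k, dist (TopologicalSpace.denseSeq Plane k) x ≤ ε := fun x => by
    obtain ⟨k, hk⟩ := (TopologicalSpace.denseRange_denseSeq Plane).exists_dist_lt x hε
    exact ⟨k, by rw [dist_comm]; exact hk.le⟩
  exact ⟨TopologicalSpace.denseSeq Plane, fun x => Nat.find (hex x),
    measurable_find hex fun k => (measurable_const.dist measurable_id) measurableSet_Iic,
    fun x => Nat.find_spec (hex x)⟩

/-- The thickening absorbs the displacement of `v`, so points in `A` stay in. A point outside the
closed set `A` is at positive distance and eventually drops out. Local finiteness leaves only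
finitely many indices to treat, which makes the threshold uniform in `j`. -/
theorem eventually_sub_mem_cthickening_iff {x : ℕ → Plane}
    (hx : ∀ R : ℕ, {j | x j ∈ Metric.closedBall 0 (R : ℝ)}.Finite) {A : Set Plane}
    (hA : IsCompact A) {ε : ℕ → ℝ} (hε : ∀ m, 0 < ε m) (hε0 : Tendsto ε atTop (𝓝 0))
    {u : ℕ → Plane} {v : Plane} (hu : ∀ m, dist (u m) v ≤ ε m) :
    ∀ᶠ m in atTop, ∀ j, x j - u m ∈ Metric.cthickening (ε m) A ↔ x j - v ∈ A := by
  obtain ⟨R, hR⟩ := (hA.isBounded.cthickening (δ := 1)).subset_closedBall 0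
  obtain ⟨M, hM⟩ := exists_nat_ge (R + ‖v‖)
  have hfin : {j | x j - v ∈ Metric.cthickening 1 A}.Finite := by
    refine (hx M).subset fun j hj => ?_
    have h1 := hR hj
    simp only [mem_closedBall_zero_iff] at h1
    show x j ∈ Metric.closedBall 0 (M : ℝ)
    rw [mem_closedBall_zero_iff]
    calc ‖x j‖ = ‖(x j - v) + v‖ := by simp
      _ ≤ ‖x j - v‖ + ‖v‖ := norm_add_le _ _
      _ ≤ M := by linarith
  -- One `ε m` comes from the thickening, the other from replacing `u m` by `v`.
  have h2ε : Tendsto (fun m => ε m + ε m) atTop (𝓝 0) := by simpa using hε0.add hε0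
  have hev : ∀ j ∈ {j | x j - v ∈ Metric.cthickening 1 A}, ∀ᶠ m in atTop,
      x j - v ∉ A → x j - v ∉ Metric.cthickening (ε m + ε m) A := by
    intro j _
    by_cases hj : x j - v ∈ A
    · exact Eventually.of_forall fun m h => absurd hj h
    · have := Metric.eventually_notMem_cthickening_of_infEDist_pos
        (hA.isClosed.closure_eq.symm ▸ hj : x j - v ∉ closure A)
      filter_upwards [h2ε.eventually this] with m hm _ using hm
  filter_upwards [(eventually_all_finite hfin).2 hev,
    h2ε.eventually (ge_mem_nhds (show (0 : ℝ) < 1 by norm_num))] with m hm hm1 j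
  constructor
  · intro h
    by_contra hj
    have h1 : x j - v ∈ Metric.cthickening (ε m + ε m) A := by
      refine Metric.cthickening_cthickening_subset (hε m).le (hε m).le A
        (Metric.mem_cthickening_of_dist_le _ _ _ _ h ?_)
      rw [dist_sub_left, dist_comm]
      exact hu m
    exact hm j (Metric.cthickening_mono hm1 _ h1) hj h1
  · intro h
    refine Metric.mem_cthickening_of_dist_le _ _ _ _ h ?_
    rw [dist_sub_left]
    exact hu m

namespace IsPPPEnumeration

variable {Ω : Type*} [MeasurableSpace Ω] {P : Measure Ω} {l : ℝ} {y : ℕ → Ω → Plane}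

theorem measurable_indicator_mul_otherCount (h : IsPPPEnumeration P l y) {B : Set Plane}
    (hB : MeasurableSet B) (f : ℕ∞ → ℝ≥0∞) {D : Plane → Set Plane}
    (hD : MeasurableSet {p : Plane × Plane | p.2 ∈ D p.1}) (i : ℕ) : Measurable fun ω =>
      B.indicator (fun _ => (1 : ℝ≥0∞)) (y i ω) * f (otherCount y i (D (y i ω)) ω) := by
  refine ((measurable_const.indicator hB).comp (h.measurable i)).mul
    (Measurable.of_discrete.comp (measurable_encard_of_measurableSet fun j => ?_))
  exact (MeasurableSet.const _).inter (((h.measurable i).prodMk (h.measurable j)) hD)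

variable [IsProbabilityMeasure P]

theorem ae_locally_finite (h : IsPPPEnumeration P l y) (hl : 0 ≤ l) :
    ∀ᵐ ω ∂P, ∀ R : ℕ, {j | y j ω ∈ Metric.closedBall 0 (R : ℝ)}.Finite := by
  refine ae_all_iff.2 fun R => ?_
  filter_upwards [h.ae_indexCount_ne_top hl (D := Metric.closedBall 0 (R : ℝ))
    measurableSet_closedBall measure_closedBall_lt_top.ne] with ω hω
  exact Set.encard_ne_top_iff.1 hω

/-- On the cell `n = k` the translated set is fixed, so `mecke_const` applies. Translation
invariance of the volume gives every cell the same expectation, and the volumes of the cells add up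
to that of `B`. -/
theorem mecke_discretized (h : IsPPPEnumeration P l y) (hl : 0 ≤ l) {B D : Set Plane}
    (hB : MeasurableSet B) (hD : MeasurableSet D) (hv : volume B ≠ ∞) (hDv : volume D ≠ ∞)
    (f : ℕ∞ → ℝ≥0∞) (q : ℕ → Plane) {n : Plane → ℕ} (hn : Measurable n) :
    ∫⁻ ω, ∑' i, B.indicator (fun _ => 1) (y i ω) *
      f (otherCount y i {z | z - q (n (y i ω)) ∈ D} ω) ∂P
      = ENNReal.ofReal l * volume B * ∫⁻ ω, f (indexCount y D ω) ∂P := by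
  have hBk : ∀ k, MeasurableSet (B ∩ n ⁻¹' {k}) := fun k =>
    hB.inter (hn (measurableSet_singleton k))
  have hDk : ∀ k, MeasurableSet {z | z - q k ∈ D} := fun k => (measurable_id.sub_const (q k)) hD
  have key : ∀ ω, ∑' i, B.indicator (fun _ => 1) (y i ω) *
      f (otherCount y i {z | z - q (n (y i ω)) ∈ D} ω)
      = ∑' k, ∑' i, (B ∩ n ⁻¹' {k}).indicator (fun _ => 1) (y i ω) *
        f (otherCount y i {z | z - q k ∈ D} ω) := by
    intro ω
    rw [ENNReal.tsum_comm]
    refine tsum_congr fun i => ?_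
    rw [tsum_eq_single (n (y i ω))]
    · by_cases hi : y i ω ∈ B <;> simp [hi]
    · intro k hk
      rw [Set.indicator_of_notMem, zero_mul]
      exact fun hi => hk hi.2.symm
  simp_rw [key]
  rw [lintegral_tsum fun k => (Measurable.tsum fun i =>
    h.measurable_indicator_mul_otherCount (hBk k) f (D := fun _ => {z | z - q k ∈ D})
      (measurable_snd (hDk k)) i).aemeasurable]
  have hvk : ∀ k, volume {z | z - q k ∈ D} = volume D := fun k => by
    have := measure_preimage_add_right volume (-q k) D
    simp only [← sub_eq_add_neg] at this
    exact this
  have hterm : ∀ k, ∫⁻ ω, ∑' i, (B ∩ n ⁻¹' {k}).indicator (fun _ => 1) (y i ω) *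
        f (otherCount y i {z | z - q k ∈ D} ω) ∂P
      = ENNReal.ofReal l * volume (B ∩ n ⁻¹' {k}) * ∫⁻ ω, f (indexCount y D ω) ∂P := fun k => by
    rw [h.mecke_const hl (hBk k) (hDk k) (measure_ne_top_of_subset Set.inter_subset_left hv),
      h.lintegral_indexCount_congr hl (hDk k) hD ((hvk k).symm ▸ hDv) (hvk k)]
  simp_rw [hterm]
  rw [ENNReal.tsum_mul_right, ENNReal.tsum_mul_left, ← measure_iUnion _ hBk, ← Set.inter_iUnion,
    ← Set.preimage_iUnion, Set.iUnion_of_singleton, Set.preimage_univ, Set.inter_univ]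
  intro i j hij
  exact Set.disjoint_left.2 fun x hi hj => hij (hi.2.symm.trans hj.2)

/-- The Mecke formula for the number of other points in a compact set attached to a point. -/
theorem mecke (h : IsPPPEnumeration P l y) (hl : 0 ≤ l) {B A : Set Plane}
    (hB : MeasurableSet B) (hA : IsCompact A) (hv : volume B ≠ ∞) {f : ℕ∞ → ℝ≥0∞}
    (hf : ∀ n, f n ≤ 1) :
    ∫⁻ ω, ∑' i, B.indicator (fun _ => 1) (y i ω) * f (otherCount y i {z | z - y i ω ∈ A} ω) ∂P
      = ENNReal.ofReal l * volume B * ∫⁻ ω, f (indexCount y A ω) ∂P := by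
  set ε : ℕ → ℝ := fun m => 1 / ((m : ℝ) + 1)
  have hε : ∀ m, 0 < ε m := fun m => by positivity
  have hε0 : Tendsto ε atTop (𝓝 0) := tendsto_one_div_add_atTop_nhds_zero_nat
  choose q n hn hqn using fun m => exists_measurable_discretization (hε m)
  have hAm : ∀ m, MeasurableSet (Metric.cthickening (ε m) A) := fun m =>
    Metric.isClosed_cthickening.measurableSet
  have hAv : ∀ m, volume (Metric.cthickening (ε m) A) ≠ ∞ := fun m =>
    hA.isBounded.cthickening.measure_lt_top.ne
  have hlim1 : Tendsto (fun m => ∫⁻ ω, ∑' i, B.indicator (fun _ => 1) (y i ω) *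
      f (otherCount y i {z | z - q m (n m (y i ω)) ∈ Metric.cthickening (ε m) A} ω) ∂P) atTop
      (𝓝 (∫⁻ ω, ∑' i, B.indicator (fun _ => 1) (y i ω) *
        f (otherCount y i {z | z - y i ω ∈ A} ω) ∂P)) := by
    -- Since `f ≤ 1`, the count in `B` dominates, and its mean is finite.
    refine tendsto_lintegral_of_dominated_convergence
      (fun ω => (indexCount y B ω : ℝ≥0∞)) (fun m => ?_) (fun m => ?_) ?_ ?_
    · refine Measurable.tsum fun i => h.measurable_indicator_mul_otherCount hB f
        (D := fun v => {z | z - q m (n m v) ∈ Metric.cthickening (ε m) A}) ?_ i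
      exact (measurable_snd.sub ((Measurable.of_discrete (f := q m)).comp
        ((hn m).comp measurable_fst))) (hAm m)
    · refine Eventually.of_forall fun ω => ?_
      simp only [indexCount]
      rw [← tsum_indicator_eq_encard]
      exact ENNReal.tsum_le_tsum fun i => mul_le_of_le_one_right' (hf _)
    · rw [(h.isPoissonCount hB hv).lintegral_coe (h.measurable_indexCount hB) (by positivity)]
      exact ENNReal.ofReal_ne_top
    · filter_upwards [h.ae_locally_finite hl, h.ae_indexCount_ne_top hl hB hv] with ω hω hωB
      have hfin : {i | y i ω ∈ B}.Finite := Set.encard_ne_top_iff.1 hωB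
      -- No continuity of `f` is assumed: the counts themselves are eventually equal, simultaneously
      -- for the finitely many `i` with a point in `B`.
      refine tendsto_nhds_of_eventually_eq ?_
      filter_upwards [(eventually_all_finite hfin).2 fun i _ =>
        eventually_sub_mem_cthickening_iff hω hA hε hε0 (v := y i ω)
          (u := fun m => q m (n m (y i ω))) fun m => hqn m _] with m hm
      refine tsum_congr fun i => ?_
      by_cases hi : y i ω ∈ B
      · congr 2
        simp only [otherCount]
        congr 1
        ext j
        exact and_congr_right fun _ => hm i hi j
      · simp [hi]
  have hlim2 : Tendsto (fun m => ∫⁻ ω, f (indexCount y (Metric.cthickening (ε m) A) ω) ∂P) atTop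
      (𝓝 (∫⁻ ω, f (indexCount y A ω) ∂P)) := by
    refine tendsto_lintegral_of_dominated_convergence (fun _ => 1)
      (fun m => Measurable.of_discrete.comp (h.measurable_indexCount (hAm m)))
      (fun m => Eventually.of_forall fun ω => hf _) (by simp) ?_
    filter_upwards [h.ae_locally_finite hl] with ω hω
    refine tendsto_nhds_of_eventually_eq ?_
    -- The same comparison without displacement: only the thickening shrinks to `A`.
    filter_upwards [eventually_sub_mem_cthickening_iff hω hA hε hε0 (v := 0)
      (u := fun _ => 0) fun m => by simpa using (hε m).le] with m hm
    simp only [sub_zero] at hm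
    simp only [indexCount]
    congr 2
    ext j
    exact hm j
  refine tendsto_nhds_unique hlim1 ?_
  simp_rw [fun m => h.mecke_discretized hl hB (hAm m) hv (hAv m) f (q m) (hn m)]
  exact ENNReal.Tendsto.const_mul hlim2
    (Or.inr (ENNReal.mul_ne_top ENNReal.ofReal_ne_top hv))

end IsPPPEnumeration

/-! ### Geometry of the exclusion regions -/

section AntennaGain

variable {N : ℕ} {d₀ wl : ℝ}

theorem antennaGain_le_one (φ : ℝ) : antennaGain N d₀ wl φ ≤ 1 := by
  unfold antennaGain
  split_ifs
  · exact Real.cos_sq_le_one _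
  · exact zero_le_one

theorem antennaGain_zero (hwl : 0 < wl) : antennaGain N d₀ wl 0 = 1 := by
  simp [antennaGain, hwl.le]

/-- At the cutoff the cosine is evaluated at `±π/2`, so the two branches agree there. -/
theorem continuous_antennaGain (hwl : 0 < wl) (hd₀ : 0 ≤ d₀) :
    Continuous (antennaGain N d₀ wl) := by
  unfold antennaGain
  refine Continuous.if_le (by fun_prop) continuous_const (by fun_prop) continuous_const ?_
  intro φ hφ
  have h1 : |Real.pi * N * d₀ / (2 * wl) * φ| = Real.pi / 2 := by
    rw [abs_mul, abs_of_nonneg (by positivity)]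
    calc Real.pi * N * d₀ / (2 * wl) * |φ| = Real.pi / (2 * wl) * (|φ| * (d₀ * N)) := by ring
      _ = Real.pi / 2 := by rw [hφ]; field_simp
  rw [← Real.cos_abs, h1, Real.cos_pi_div_two]
  norm_num

end AntennaGain

section CleanedRegion

variable {R : ℝ} {G : ℝ → ℝ} {a b : Plane}

/-- The apex `a` is excluded because the angle is discontinuous at the zero vector. -/
theorem continuousAt_cleanedRange (hG : Continuous G) (hab : a ≠ b) {z : Plane} (hz : z ≠ a) :
    ContinuousAt (fun z => R * √(G (InnerProductGeometry.angle (z - a) (b - a)))) z := by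
  have h1 : ContinuousAt (fun z => InnerProductGeometry.angle (z - a) (b - a)) z :=
    ContinuousAt.comp (f := fun z => (z - a, b - a))
      (InnerProductGeometry.continuousAt_angle (x := (z - a, b - a)) (sub_ne_zero.2 hz)
        (sub_ne_zero.2 hab.symm)) (by fun_prop)
  exact continuousAt_const.mul
    ((Real.continuous_sqrt.comp hG).continuousAt.comp (f := fun z => _) h1)

theorem self_mem_cleanedRegion (hR : 0 ≤ R) : a ∈ cleanedRegion R G a b := by
  show ‖a - a‖ ≤ _
  rw [sub_self, norm_zero]
  positivity

/-- The apex, where the range may jump, belongs to the region; at every point of the complement the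
defining strict inequality is continuous, hence open. -/
theorem isCompact_cleanedRegion (hR : 0 ≤ R) (hG : Continuous G) (hG1 : ∀ φ, G φ ≤ 1)
    (hab : a ≠ b) : IsCompact (cleanedRegion R G a b) := by
  refine Metric.isCompact_of_isClosed_isBounded ?_ ?_
  · refine ⟨isOpen_iff_mem_nhds.2 fun z hz => ?_⟩
    have hza : z ≠ a := by
      rintro rfl
      exact hz (self_mem_cleanedRegion hR)
    have hlt : R * √(G (InnerProductGeometry.angle (z - a) (b - a))) < ‖z - a‖ := not_le.1 hz
    have hn : ContinuousAt (fun z => ‖z - a‖) z := by fun_prop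
    filter_upwards [(continuousAt_cleanedRange hG hab hza).eventually_lt hn hlt] with w hw
    exact not_le.2 hw
  · refine (Metric.isBounded_closedBall (x := a) (r := R)).subset fun z hz => ?_
    rw [mem_closedBall_iff_norm]
    exact le_trans hz (mul_le_of_le_one_right hR (Real.sqrt_le_one.2 (hG1 _)))

theorem volume_cleanedRegion_pos (hR : 0 < R) (hG : Continuous G) (hG0 : G 0 = 1)
    (hab : a ≠ b) : 0 < volume (cleanedRegion R G a b) := by
  have hn : 0 < ‖b - a‖ := norm_pos_iff.2 (sub_ne_zero.2 hab.symm)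
  -- This places `z` on the beam axis at half the range, where the gain is `1` and the inequality is
  -- strict, so a whole neighborhood belongs to the region.
  set t : ℝ := R / (2 * ‖b - a‖)
  have ht : 0 < t := by positivity
  set z : Plane := a + t • (b - a)
  have hz : z - a = t • (b - a) := by simp [z]
  have hza : z ≠ a := by
    rw [← sub_ne_zero, hz]
    exact smul_ne_zero ht.ne' (sub_ne_zero.2 hab.symm)
  have hang : InnerProductGeometry.angle (z - a) (b - a) = 0 := by
    rw [hz, InnerProductGeometry.angle_smul_left_of_pos _ _ ht,
      InnerProductGeometry.angle_self (sub_ne_zero.2 hab.symm)]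
  have hlt : ‖z - a‖ < R * √(G (InnerProductGeometry.angle (z - a) (b - a))) := by
    rw [hang, hG0, Real.sqrt_one, hz, norm_smul, Real.norm_of_nonneg ht.le]
    have : t * ‖b - a‖ = R / 2 := by simp only [t]; field_simp
    linarith
  have hc : ContinuousAt (fun z => ‖z - a‖) z := by fun_prop
  refine Measure.measure_pos_of_mem_nhds volume (x := z) ?_
  filter_upwards [hc.eventually_lt (continuousAt_cleanedRange hG hab hza) hlt] with w hw
  exact hw.le

theorem add_mem_cleanedRegion_add_iff (v z : Plane) :
    z + v ∈ cleanedRegion R G (a + v) (b + v) ↔ z ∈ cleanedRegion R G a b := by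
  simp only [cleanedRegion, Set.mem_ofPred_eq, add_sub_add_right_eq_sub]

theorem map_mem_cleanedRegion_map_iff (e : Plane ≃ₗᵢ[ℝ] Plane) (z : Plane) :
    e z ∈ cleanedRegion R G (e a) (e b) ↔ z ∈ cleanedRegion R G a b := by
  simp only [cleanedRegion, Set.mem_ofPred_eq, ← map_sub, e.norm_map]
  rw [← LinearIsometryEquiv.coe_toLinearIsometry, LinearIsometry.angle_map]

theorem measurableSet_mem_cleanedRegion {α : Type*} [MeasurableSpace α] (hG : Continuous G)
    {a b z : α → Plane} (ha : Measurable a) (hb : Measurable b) (hz : Measurable z) :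
    MeasurableSet {x | z x ∈ cleanedRegion R G (a x) (b x)} := by
  have hang : Measurable fun x => InnerProductGeometry.angle (z x - a x) (b x - a x) := by
    unfold InnerProductGeometry.angle
    exact Real.continuous_arccos.measurable.comp (((hz.sub ha).inner (hb.sub ha)).div
      ((hz.sub ha).norm.mul (hb.sub ha).norm))
  exact measurableSet_le (hz.sub ha).norm
    (((Real.continuous_sqrt.comp hG).measurable.comp hang).const_mul R)

end CleanedRegion

namespace RTSCTSConfig

variable (c : RTSCTSConfig)

theorem isCompact_exclusionRegion {y x : Plane} (hyx : y ≠ x) :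
    IsCompact (c.exclusionRegion y x) :=
  (isCompact_cleanedRegion c.Rt_pos.le (continuous_antennaGain c.wl_pos c.d₀_nonneg)
    antennaGain_le_one hyx).union
  (isCompact_cleanedRegion c.Rr_pos.le (continuous_antennaGain c.wl_pos c.d₀_nonneg)
    antennaGain_le_one hyx.symm)

theorem volume_exclusionRegion_pos {y x : Plane} (hyx : y ≠ x) :
    0 < volume (c.exclusionRegion y x) :=
  (volume_cleanedRegion_pos c.Rt_pos (continuous_antennaGain c.wl_pos c.d₀_nonneg)
    (antennaGain_zero c.wl_pos) hyx).trans_le (measure_mono Set.subset_union_left)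

theorem add_mem_exclusionRegion_add_iff (y x v z : Plane) :
    z + v ∈ c.exclusionRegion (y + v) (x + v) ↔ z ∈ c.exclusionRegion y x :=
  or_congr (add_mem_cleanedRegion_add_iff v z) (add_mem_cleanedRegion_add_iff v z)

theorem map_mem_exclusionRegion_map_iff (e : Plane ≃ₗᵢ[ℝ] Plane) (y x z : Plane) :
    e z ∈ c.exclusionRegion (e y) (e x) ↔ z ∈ c.exclusionRegion y x :=
  or_congr (map_mem_cleanedRegion_map_iff e z) (map_mem_cleanedRegion_map_iff e z)

theorem receiver_add (y v : Plane) (θ : ℝ) : c.receiver (y + v) θ = c.receiver y θ + v := by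
  simp only [receiver]
  abel

theorem measurable_receiver : Measurable fun p : Plane × ℝ => c.receiver p.1 p.2 := by
  unfold receiver
  refine measurable_fst.add (Measurable.const_smul ?_ c.d)
  refine (WithLp.measurable_toLp 2 _).comp (measurable_pi_iff.2 fun i => ?_)
  fin_cases i
  · exact Real.measurable_cos.comp measurable_snd
  · exact Real.measurable_sin.comp measurable_snd

theorem measurableSet_mem_exclusionRegion {α : Type*} [MeasurableSpace α] {y z : α → Plane}
    {θ : α → ℝ} (hy : Measurable y) (hθ : Measurable θ) (hz : Measurable z) :
    MeasurableSet {a | z a ∈ c.exclusionRegion (y a) (c.receiver (y a) (θ a))} := by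
  have hx := c.measurable_receiver.comp (hy.prodMk hθ)
  have hG : ∀ N, Continuous (antennaGain N c.d₀ c.wl) := fun N =>
    continuous_antennaGain c.wl_pos c.d₀_nonneg
  exact (measurableSet_mem_cleanedRegion (hG _) hy hx hz).union
    (measurableSet_mem_cleanedRegion (hG _) hx hy hz)

/-- The exclusion region of a pair with transmitter at the origin and orientation `θ`. -/
def regionAt (θ : ℝ) : Set Plane := c.exclusionRegion 0 (c.receiver 0 θ)

theorem mem_exclusionRegion_receiver_iff (y z : Plane) (θ : ℝ) :
    z ∈ c.exclusionRegion y (c.receiver y θ) ↔ z - y ∈ c.regionAt θ := by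
  have h := c.add_mem_exclusionRegion_add_iff 0 (c.receiver 0 θ) y (z - y)
  rwa [sub_add_cancel, zero_add, ← receiver_add, zero_add] at h

theorem norm_receiver_zero (θ : ℝ) : ‖c.receiver 0 θ‖ = c.d := by
  rw [receiver, zero_add, norm_smul, Real.norm_of_nonneg c.d_pos.le, EuclideanSpace.norm_eq]
  simp [Fin.sum_univ_two, Real.cos_sq_add_sin_sq]

theorem receiver_zero_ne (θ : ℝ) : 0 ≠ c.receiver 0 θ := by
  intro h
  have h1 := c.norm_receiver_zero θ
  rw [← h, norm_zero] at h1
  exact c.d_pos.ne h1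

theorem receiver_zero_zero : c.receiver 0 0 = !₂[c.d, 0] := by
  ext i
  fin_cases i <;> simp [receiver]

theorem isCompact_regionAt (θ : ℝ) : IsCompact (c.regionAt θ) :=
  c.isCompact_exclusionRegion (c.receiver_zero_ne θ)

/-- Two receivers at the same distance `d` from the origin are exchanged by a reflection fixing the
origin. A reflection will do in place of a rotation because the angles are unoriented. -/
theorem volume_regionAt (θ : ℝ) : volume (c.regionAt θ) = volume (c.regionAt 0) := by
  set e : Plane ≃ₗᵢ[ℝ] Plane :=
    Submodule.reflection (Submodule.span ℝ {c.receiver 0 0 - c.receiver 0 θ})ᗮ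
  have he : e (c.receiver 0 0) = c.receiver 0 θ :=
    Submodule.reflection_sub (by rw [norm_receiver_zero, norm_receiver_zero])
  rw [← e.measurePreserving.measure_preimage
    (c.isCompact_regionAt θ).isClosed.measurableSet.nullMeasurableSet]
  congr 1
  ext z
  have := c.map_mem_exclusionRegion_map_iff e 0 (c.receiver 0 0) z
  rw [he, map_zero] at this
  exact this

theorem regionAt_zero : c.regionAt 0 = c.exclusionRegion 0 !₂[c.d, 0] := by
  rw [regionAt, receiver_zero_zero]

theorem volume_exclusionRegion_ne_top : volume (c.exclusionRegion 0 !₂[c.d, 0]) ≠ ∞ := by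
  rw [← regionAt_zero]
  exact (c.isCompact_regionAt 0).measure_lt_top.ne

theorem Vo_pos : 0 < c.Vo := by
  refine ENNReal.toReal_pos ?_ c.volume_exclusionRegion_ne_top
  rw [← receiver_zero_zero]
  exact (c.volume_exclusionRegion_pos (c.receiver_zero_ne 0)).ne'

theorem volume_real_regionAt (θ : ℝ) : volume.real (c.regionAt θ) = c.Vo := by
  rw [Measure.real, volume_regionAt, regionAt_zero]
  rfl

end RTSCTSConfig

/-! ### Averaging over the marks -/

/-- The weight at `k` divided by `k + 1` is the weight at `k + 1` divided by `a`; the sum then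
misses only the weight `exp (-a)` at zero. -/
theorem IsPoissonCount.lintegral_inv_add_one {Ω : Type*} [MeasurableSpace Ω] {P : Measure Ω}
    [IsProbabilityMeasure P] {N : Ω → ℕ∞} {a : ℝ} (h : IsPoissonCount P N a) (hN : Measurable N)
    (ha : 0 < a) :
    ∫⁻ ω, ((N ω : ℝ≥0∞) + 1)⁻¹ ∂P = ENNReal.ofReal ((1 - Real.exp (-a)) / a) := by
  rw [h.lintegral_comp hN ha.le fun n => ((n : ℝ≥0∞) + 1)⁻¹]
  have hs : HasSum (fun k : ℕ => Real.exp (-a) * a ^ k / k.factorial) 1 :=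
    hasSum_one_poissonMeasure ⟨a, ha.le⟩
  have hs1 := ((hasSum_nat_add_iff' 1).2 hs).div_const a
  simp only [Finset.range_one, Finset.sum_singleton, pow_zero, Nat.factorial_zero, Nat.cast_one,
    mul_one, div_one] at hs1
  rw [← hs1.tsum_eq, ENNReal.ofReal_tsum_of_nonneg (fun k => by positivity) hs1.summable]
  refine tsum_congr fun k => ?_
  have h2 : ((k : ℕ∞) : ℝ≥0∞) + 1 = ENNReal.ofReal (k + 1) := by
    rw [ENat.toENNReal_coe, ENNReal.ofReal_add (by positivity) zero_le_one,
      ENNReal.ofReal_natCast, ENNReal.ofReal_one]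
  rw [h2, ← ENNReal.ofReal_inv_of_pos (by positivity), ← ENNReal.ofReal_mul (by positivity)]
  congr 1
  rw [Nat.factorial_succ]
  push_cast
  field_simp
  ring

theorem map_eq_restrict_of_isUniform {Ω : Type*} [MeasurableSpace Ω] {P : Measure Ω}
    {t : Ω → ℝ} (ht : pdf.IsUniform t (Set.Icc 0 1) P) :
    P.map t = volume.restrict (Set.Icc (0 : ℝ) 1) := by
  have h : P.map t = ProbabilityTheory.cond volume (Set.Icc (0 : ℝ) 1) := ht
  rw [h, ProbabilityTheory.cond]
  simp

theorem lintegral_Icc_one_sub_pow (n : ℕ) :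
    ∫⁻ x in Set.Icc (0 : ℝ) 1, ENNReal.ofReal (1 - x) ^ n = ((n : ℝ≥0∞) + 1)⁻¹ := by
  have h1 : ∫⁻ x in Set.Icc (0 : ℝ) 1, ENNReal.ofReal (1 - x) ^ n
      = ∫⁻ x in Set.Icc (0 : ℝ) 1, ENNReal.ofReal ((1 - x) ^ n) := by
    refine setLIntegral_congr_fun measurableSet_Icc fun x hx => ?_
    exact (ENNReal.ofReal_pow (sub_nonneg.2 hx.2) n).symm
  rw [h1, ← ofReal_integral_eq_lintegral_ofReal, integral_Icc_eq_integral_Ioc,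
    ← intervalIntegral.integral_of_le zero_le_one,
    intervalIntegral.integral_comp_sub_left fun x : ℝ => x ^ n]
  · simp only [sub_self, sub_zero, integral_pow, one_pow, zero_pow (Nat.succ_ne_zero n)]
    rw [one_div, ENNReal.ofReal_inv_of_pos (by positivity),
      ENNReal.ofReal_add (by positivity) zero_le_one, ENNReal.ofReal_natCast, ENNReal.ofReal_one]
  · exact (Continuous.integrableOn_Icc (by fun_prop))
  · filter_upwards [ae_restrict_mem measurableSet_Icc] with x hx
    exact pow_nonneg (sub_nonneg.2 hx.2) n

/-- The probability that a given one among i.i.d. uniform time marks is the smallest. -/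
theorem measure_forall_le_of_uniform {Ω : Type*} [MeasurableSpace Ω] {P : Measure Ω}
    [IsProbabilityMeasure P] {t : ℕ → Ω → ℝ} (hm : ∀ i, Measurable (t i))
    (hu : ∀ i, pdf.IsUniform (t i) (Set.Icc 0 1) P) (hind : iIndepFun t P) {i : ℕ}
    {J : Finset ℕ} (hi : i ∉ J) :
    P {ω | ∀ j ∈ J, t i ω ≤ t j ω} = ((J.card : ℝ≥0∞) + 1)⁻¹ := by
  have hmJ : Measurable fun ω (j : J) => t j ω := measurable_pi_iff.2 fun j => hm j
  have hpair : IndepFun (t i) (fun ω (j : J) => t j ω) P :=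
    (hind.indepFun_finset {i} J (Finset.disjoint_singleton_left.2 hi) hm).comp
      (φ := fun x : ({i} : Finset ℕ) → ℝ => x ⟨i, Finset.mem_singleton_self i⟩)
      (measurable_pi_apply (X := fun _ : ({i} : Finset ℕ) => ℝ) _) measurable_id
  have hset : MeasurableSet {p : ℝ × (J → ℝ) | ∀ j, p.1 ≤ p.2 j} := by
    rw [Set.ofPred_forall]
    exact MeasurableSet.iInter fun j =>
      measurableSet_le measurable_fst ((measurable_pi_apply j).comp measurable_snd)
  set G : ℝ → (J → ℝ) → ℝ≥0∞ :=
    fun x u => {p : ℝ × (J → ℝ) | ∀ j, p.1 ≤ p.2 j}.indicator (fun _ => 1) (x, u) with hGdef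
  have hG : Measurable (Function.uncurry G) := measurable_const.indicator hset
  have hset' : MeasurableSet {ω | ∀ j ∈ J, t i ω ≤ t j ω} := by
    simp_rw [Set.ofPred_forall]
    exact MeasurableSet.iInter fun j => MeasurableSet.iInter fun _ =>
      measurableSet_le (hm i) (hm j)
  have h1 : P {ω | ∀ j ∈ J, t i ω ≤ t j ω} = ∫⁻ ω, G (t i ω) (fun j => t j ω) ∂P := by
    rw [← lintegral_indicator_one hset']
    refine lintegral_congr fun ω => ?_
    simp only [hGdef, Set.indicator_apply, Set.mem_ofPred_eq, Subtype.forall, Pi.one_apply]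
  -- Given the value `x` of the mark `t i`, the marks in `J` are independent and each is at least
  -- `x` with probability `1 - x`. Integrating this power over `x` yields the claim.
  have hprob : ∀ x ∈ Set.Icc (0 : ℝ) 1,
      ∫⁻ ω, G x (fun j => t j ω) ∂P = ENNReal.ofReal (1 - x) ^ J.card := by
    intro x hx
    have hset'' : {ω | ∀ j ∈ J, x ≤ t j ω} = ⋂ j ∈ J, t j ⁻¹' Set.Ici x := by
      ext ω
      simp
    have h2 : ∫⁻ ω, G x (fun j => t j ω) ∂P = P {ω | ∀ j ∈ J, x ≤ t j ω} := by
      rw [← lintegral_indicator_one (hset'' ▸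
        Finset.measurableSet_biInter _ fun j _ => hm j measurableSet_Ici)]
      refine lintegral_congr fun ω => ?_
      simp only [hGdef, Set.indicator_apply, Set.mem_ofPred_eq, Subtype.forall, Pi.one_apply]
    rw [h2, hset'', hind.meas_biInter fun j _ => ⟨Set.Ici x, measurableSet_Ici, rfl⟩]
    rw [Finset.prod_congr rfl (g := fun _ => ENNReal.ofReal (1 - x)), Finset.prod_const]
    intro j _
    have h3 : P (t j ⁻¹' Set.Ici x) = P.map (t j) (Set.Ici x) :=
      (Measure.map_apply (hm j) measurableSet_Ici).symm
    have h4 : Set.Ici x ∩ Set.Icc 0 1 = Set.Icc x 1 := by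
      ext z
      exact ⟨fun h => ⟨h.1, h.2.2⟩, fun h => ⟨h.1, hx.1.trans h.1, h.2⟩⟩
    rw [h3, map_eq_restrict_of_isUniform (hu j), Measure.restrict_apply measurableSet_Ici, h4,
      Real.volume_Icc]
  have h5 : ∫⁻ ω, ∫⁻ ω', G (t i ω) (fun j => t j ω') ∂P ∂P
      = ∫⁻ x, ∫⁻ ω', G x (fun j => t j ω') ∂P ∂(P.map (t i)) := by
    refine (lintegral_map (f := fun x => ∫⁻ ω', G x (fun j => t j ω') ∂P) ?_ (hm i)).symm
    exact Measurable.lintegral_prod_right' (f := fun p : ℝ × Ω => G p.1 fun j => t j p.2)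
      (hG.comp (measurable_fst.prodMk (hmJ.comp measurable_snd)))
  rw [h1, hpair.lintegral_comp_eq (hm i) hmJ hG, h5, map_eq_restrict_of_isUniform (hu i),
    setLIntegral_congr_fun measurableSet_Icc hprob, lintegral_Icc_one_sub_pow]

namespace BipolarProcess

variable {Ω : Type*} [MeasurableSpace Ω] {P : Measure Ω} {l : ℝ} (X : BipolarProcess P l)
  (c : RTSCTSConfig)

theorem isPPPEnumeration : IsPPPEnumeration P l X.y :=
  ⟨X.measurable_y, X.injective_y, X.isPPP⟩

/-- The indices of the transmitters other than `i` in the exclusion region of the pair `i`. -/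
def neighborIndices (i : ℕ) (ω : Ω) : Set ℕ :=
  {j | j ≠ i ∧ X.y j ω - X.y i ω ∈ c.regionAt (X.θ i ω)}

theorem measurableSet_mem_neighborIndices (i j : ℕ) :
    MeasurableSet {p : ℝ × (ℕ → Plane) | j ≠ i ∧ p.2 j - p.2 i ∈ c.regionAt p.1} := by
  have h := c.measurableSet_mem_exclusionRegion (α := ℝ × (ℕ → Plane)) (y := fun p => p.2 i)
    (z := fun p => p.2 j) (θ := fun p => p.1) ((measurable_pi_apply i).comp measurable_snd)
    measurable_fst ((measurable_pi_apply j).comp measurable_snd)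
  simp only [c.mem_exclusionRegion_receiver_iff] at h
  exact (MeasurableSet.const _).inter h

variable [IsProbabilityMeasure P]

theorem ae_neighborIndices_finite (hl : 0 ≤ l) :
    ∀ᵐ ω ∂P, ∀ i, (X.neighborIndices c i ω).Finite := by
  filter_upwards [X.isPPPEnumeration.ae_locally_finite hl] with ω hω i
  obtain ⟨R, hR⟩ := (c.isCompact_regionAt (X.θ i ω)).isBounded.subset_closedBall 0
  obtain ⟨M, hM⟩ := exists_nat_ge (R + ‖X.y i ω‖)
  refine (hω M).subset fun j hj => ?_
  have h1 := hR hj.2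
  rw [mem_closedBall_zero_iff] at h1
  show X.y j ω ∈ Metric.closedBall 0 (M : ℝ)
  rw [mem_closedBall_zero_iff]
  calc ‖X.y j ω‖ = ‖(X.y j ω - X.y i ω) + X.y i ω‖ := by simp
    _ ≤ ‖X.y j ω - X.y i ω‖ + ‖X.y i ω‖ := norm_add_le _ _
    _ ≤ M := by linarith

/-- The Mecke formula for the number of neighbors in the exclusion region. -/
theorem mecke (hl : 0 ≤ l) {B : Set Plane} (hB : MeasurableSet B) (hv : volume B ≠ ∞)
    {f : ℕ∞ → ℝ≥0∞} (hf : ∀ n, f n ≤ 1) :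
    ∑' i, ∫⁻ ω, B.indicator (fun _ => 1) (X.y i ω) * f (X.neighborIndices c i ω).encard ∂P
      = ENNReal.ofReal l * volume B * ∫⁻ ω, f (indexCount X.y (c.regionAt 0) ω) ∂P := by
  set G : ℕ → ℝ → (ℕ → Plane) → ℝ≥0∞ := fun i θ u => B.indicator (fun _ => 1) (u i) *
    f {j | j ≠ i ∧ u j - u i ∈ c.regionAt θ}.encard with hGdef
  have hG : ∀ i, Measurable (Function.uncurry (G i)) := fun i =>
    ((measurable_const.indicator hB).comp ((measurable_pi_apply i).comp measurable_snd)).mul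
      (Measurable.of_discrete.comp (measurable_encard_of_measurableSet fun j =>
        measurableSet_mem_neighborIndices c i j))
  have hmy : Measurable fun ω i => X.y i ω := measurable_pi_iff.2 X.measurable_y
  have hGy : ∀ i, Measurable fun θ => ∫⁻ ω, G i θ (fun j => X.y j ω) ∂P := fun i =>
    Measurable.lintegral_prod_right' (f := fun p : ℝ × Ω => G i p.1 fun j => X.y j p.2)
      ((hG i).comp (measurable_fst.prodMk (hmy.comp measurable_snd)))
  -- Each `θ i` is independent of the points and has the law of `θ 0`. Using `θ 0` in every term
  -- puts one common orientation outside the sum over `i`.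
  have hterm : ∀ i, ∫⁻ ω, B.indicator (fun _ => 1) (X.y i ω) *
      f (X.neighborIndices c i ω).encard ∂P
      = ∫⁻ ω, ∫⁻ ω', G i (X.θ 0 ω) (fun j => X.y j ω') ∂P ∂P := by
    intro i
    have hind : IndepFun (X.θ i) (fun ω j => X.y j ω) P :=
      (X.indep_y_θ.comp (ψ := fun u : ℕ → ℝ => u i) measurable_id (measurable_pi_apply i)).symm
    have h1 := hind.lintegral_comp_eq (X.measurable_θ i) hmy (hG i)
    have h2 : P.map (X.θ i) = P.map (X.θ 0) := (X.uniform_θ i).trans (X.uniform_θ 0).symm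
    refine h1.trans ?_
    rw [← lintegral_map (hGy i) (X.measurable_θ i), h2, lintegral_map (hGy i) (X.measurable_θ 0)]
  simp_rw [hterm]
  have hGθ : ∀ i, Measurable fun ω => ∫⁻ ω', G i (X.θ 0 ω) (fun j => X.y j ω') ∂P := fun i =>
    (hGy i).comp (X.measurable_θ 0)
  rw [← lintegral_tsum fun i => (hGθ i).aemeasurable]
  -- For a frozen orientation the region is a fixed compact set; the result depends on its area
  -- only, hence not on the orientation.
  have hin : ∀ ω, ∑' i, ∫⁻ ω', G i (X.θ 0 ω) (fun j => X.y j ω') ∂P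
      = ENNReal.ofReal l * volume B * ∫⁻ ω, f (indexCount X.y (c.regionAt 0) ω) ∂P := by
    intro ω
    have hA := fun θ => (c.isCompact_regionAt θ)
    have hGω : ∀ i, Measurable fun ω' => G i (X.θ 0 ω) fun j => X.y j ω' := fun i =>
      (hG i).comp (measurable_const.prodMk hmy)
    rw [← lintegral_tsum fun i => (hGω i).aemeasurable,
      X.isPPPEnumeration.lintegral_indexCount_congr hl (hA 0).isClosed.measurableSet
        (hA (X.θ 0 ω)).isClosed.measurableSet (hA 0).measure_lt_top.ne (c.volume_regionAt _).symm,
      ← X.isPPPEnumeration.mecke hl hB (hA _) hv hf]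
    rfl
  simp_rw [hin]
  simp

end BipolarProcess

/-! ### Means of thinned processes -/

theorem volume_unit_square : volume {v : Plane | ∀ k, v k ∈ Set.Ico (0 : ℝ) 1} = 1 := by
  have h : {v : Plane | ∀ k, v k ∈ Set.Ico (0 : ℝ) 1}
      = (@WithLp.ofLp 2 (Fin 2 → ℝ)) ⁻¹' (Set.univ.pi fun _ => Set.Ico (0 : ℝ) 1) := by
    ext v
    simp
  rw [h, (PiLp.volume_preserving_ofLp (Fin 2)).measure_preimage
    (MeasurableSet.univ_pi fun _ => measurableSet_Ico).nullMeasurableSet, Real.volume_pi_Ico]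
  simp

theorem measurableSet_unit_square : MeasurableSet {v : Plane | ∀ k, v k ∈ Set.Ico (0 : ℝ) 1} := by
  rw [Set.ofPred_forall]
  exact MeasurableSet.iInter fun k => (by fun_prop : Measurable fun v : Plane => v k)
    measurableSet_Ico

section Thinning

variable {Ω : Type*} [MeasurableSpace Ω] {P : Measure Ω} {y : ℕ → Ω → Plane} {A : ℕ → Set Ω}

theorem lintegral_encard_index (hy : ∀ i, Measurable (y i)) (hA : ∀ i, MeasurableSet (A i))
    {B : Set Plane} (hB : MeasurableSet B) :
    ∫⁻ ω, (({i | y i ω ∈ B ∧ ω ∈ A i}.encard : ℕ∞) : ℝ≥0∞) ∂P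
      = ∑' i, P (y i ⁻¹' B ∩ A i) := by
  have hm : ∀ i, MeasurableSet (y i ⁻¹' B ∩ A i) := fun i => (hy i hB).inter (hA i)
  have h1 : ∀ ω, (({i | y i ω ∈ B ∧ ω ∈ A i}.encard : ℕ∞) : ℝ≥0∞)
      = ∑' i, (y i ⁻¹' B ∩ A i).indicator (fun _ => 1) ω := by
    intro ω
    rw [← ENNReal.tsum_set_one, tsum_subtype {i | y i ω ∈ B ∧ ω ∈ A i} fun _ => (1 : ℝ≥0∞)]
    rfl
  simp_rw [h1]
  rw [lintegral_tsum fun i => (measurable_const.indicator (hm i)).aemeasurable]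
  refine tsum_congr fun i => ?_
  rw [lintegral_indicator_const (hm i), one_mul]

/-- Both sides are measures in `B`, so agreement inside each piece of a countable cover by sets of
finite area extends to sets of infinite area. -/
theorem tsum_measure_eq_of_finite (hy : ∀ i, Measurable (y i)) {b : ℝ≥0∞}
    (h : ∀ B : Set Plane, MeasurableSet B → volume B ≠ ∞ →
      ∑' i, P (y i ⁻¹' B ∩ A i) = b * volume B)
    {B : Set Plane} (hB : MeasurableSet B) :
    ∑' i, P (y i ⁻¹' B ∩ A i) = b * volume B := by
  set μ : Measure Plane := Measure.sum fun i => (P.restrict (A i)).map (y i)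
  have hμ : ∀ C, MeasurableSet C → μ C = ∑' i, P (y i ⁻¹' C ∩ A i) := by
    intro C hC
    rw [Measure.sum_apply _ hC]
    refine tsum_congr fun i => ?_
    rw [Measure.map_apply (hy i) hC, Measure.restrict_apply (hy i hC)]
  have heq : μ = b • volume := by
    refine Measure.ext_of_iUnion_eq_univ (iUnion_spanningSets (volume : Measure Plane))
      fun n => ?_
    have hn := measurableSet_spanningSets (volume : Measure Plane) n
    ext C hC
    rw [Measure.restrict_apply hC, Measure.restrict_apply hC, hμ _ (hC.inter hn),
      h _ (hC.inter hn) (measure_ne_top_of_subset Set.inter_subset_right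
        (measure_spanningSets_lt_top volume n).ne)]
    rfl
  rw [← hμ B hB, heq]
  rfl

theorem hasIntensity_of_index (hy : ∀ i, Measurable (y i)) (hA : ∀ i, MeasurableSet (A i))
    (hinj : ∀ᵐ ω ∂P, Function.Injective fun i => y i ω) {Φ : Ω → Set Plane}
    (hΦ : ∀ ω, (Function.Injective fun i => y i ω) → Φ ω = (fun i => y i ω) '' {i | ω ∈ A i})
    {b : ℝ} (h : ∀ B : Set Plane, MeasurableSet B → volume B ≠ ∞ →
      ∑' i, P (y i ⁻¹' B ∩ A i) = ENNReal.ofReal b * volume B) :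
    HasIntensity P Φ b := by
  intro B hB
  rw [← tsum_measure_eq_of_finite hy h hB, ← lintegral_encard_index hy hA hB]
  refine lintegral_congr_ae ?_
  filter_upwards [hinj] with ω hω
  rw [hΦ ω hω, ← hω.encard_image {i | y i ω ∈ B ∧ ω ∈ A i}]
  congr 2
  ext z
  constructor
  · rintro ⟨⟨i, hi, rfl⟩, hz⟩
    exact ⟨i, ⟨hz, hi⟩, rfl⟩
  · rintro ⟨i, ⟨hz, hi⟩, rfl⟩
    exact ⟨⟨i, hi, rfl⟩, hz⟩

/-- The unit square has area one, so the mean in the definition of `palmProb` is `l * r`. The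
hypothesis `hS` translates the event seen from the `i`th point into `A i`. -/
theorem palmProb_of_index {K : Type*} (hy : ∀ i, Measurable (y i))
    (hA : ∀ i, MeasurableSet (A i)) (hinj : ∀ᵐ ω ∂P, Function.Injective fun i => y i ω)
    {m : ℕ → Ω → K} {S : Set (Set (Plane × K))}
    (hS : ∀ ω, (Function.Injective fun i => y i ω) → ∀ i,
      translateConfig (-y i ω) (Set.range fun j => (y j ω, m j ω)) ∈ S ↔ ω ∈ A i)
    {l : ℝ} (hl : 0 < l) {r : ℝ≥0∞} (h : ∀ B : Set Plane, MeasurableSet B → volume B ≠ ∞ →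
      ∑' i, P (y i ⁻¹' B ∩ A i) = ENNReal.ofReal l * r * volume B) :
    palmProb P l (fun ω => Set.range fun j => (y j ω, m j ω)) S = r := by
  have h1 := h _ measurableSet_unit_square (by rw [volume_unit_square]; exact ENNReal.one_ne_top)
  rw [volume_unit_square, mul_one] at h1
  refine ((ENNReal.eq_div_iff (ENNReal.ofReal_pos.2 hl).ne' ENNReal.ofReal_ne_top).2 ?_).symm
  rw [← h1, ← lintegral_encard_index hy hA measurableSet_unit_square]
  refine lintegral_congr_ae ?_
  filter_upwards [hinj] with ω hω
  have hω' : Function.Injective fun j => (y j ω, m j ω) := fun i j hij =>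
    hω (congrArg Prod.fst hij)
  rw [← hω'.encard_image {i | (∀ k, y i ω k ∈ Set.Ico (0 : ℝ) 1) ∧ ω ∈ A i}]
  congr 2
  ext z
  constructor
  · rintro ⟨i, ⟨hz, hi⟩, rfl⟩
    exact ⟨⟨i, rfl⟩, hz, (hS ω hω i).2 hi⟩
  · rintro ⟨⟨i, rfl⟩, hz, hzS⟩
    exact ⟨i, ⟨hz, (hS ω hω i).1 hzS⟩, rfl⟩

end Thinning

/-! ### Translation covariance of the thinning rules -/

theorem translateConfig_injective {K : Type*} (v : Plane) :
    Function.Injective fun p : Plane × K => (p.1 + v, p.2) := by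
  rintro ⟨a, k⟩ ⟨b, k'⟩ h
  simp only [Prod.mk.injEq, add_left_inj] at h
  exact Prod.ext h.1 h.2

namespace RTSCTSConfig

variable (c : RTSCTSConfig)

theorem neighborsI_translateConfig (v : Plane) (ψ : Set (Plane × ℝ)) (p : Plane × ℝ) :
    c.neighborsI (translateConfig v ψ) (p.1 + v, p.2) = translateConfig v (c.neighborsI ψ p) := by
  ext q
  constructor
  · rintro ⟨⟨⟨q, hq, rfl⟩, hne⟩, hmem⟩
    refine ⟨q, ⟨⟨hq, fun h => hne ?_⟩, ?_⟩, rfl⟩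
    · rw [Set.mem_singleton_iff.1 h]
      rfl
    · rwa [receiver_add, add_mem_exclusionRegion_add_iff] at hmem
  · rintro ⟨q, ⟨⟨hq, hne⟩, hmem⟩, rfl⟩
    refine ⟨⟨⟨q, hq, rfl⟩, fun h => hne (translateConfig_injective v h)⟩, ?_⟩
    rwa [receiver_add, add_mem_exclusionRegion_add_iff]

theorem neighborsII_translateConfig (v : Plane) (ψ : Set (Plane × ℝ × ℝ)) (p : Plane × ℝ × ℝ) :
    c.neighborsII (translateConfig v ψ) (p.1 + v, p.2)
      = translateConfig v (c.neighborsII ψ p) := by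
  ext q
  constructor
  · rintro ⟨⟨⟨q, hq, rfl⟩, hne⟩, hmem, ht⟩
    refine ⟨q, ⟨⟨hq, fun h => hne ?_⟩, ?_, ht⟩, rfl⟩
    · rw [Set.mem_singleton_iff.1 h]
      rfl
    · rwa [receiver_add, add_mem_exclusionRegion_add_iff] at hmem
  · rintro ⟨q, ⟨⟨hq, hne⟩, hmem, ht⟩, rfl⟩
    refine ⟨⟨⟨q, hq, rfl⟩, fun h => hne (translateConfig_injective v h)⟩, ?_, ht⟩
    rwa [receiver_add, add_mem_exclusionRegion_add_iff]

/-- Retention depends on relative positions only; this turns the Palm event at the origin into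
retention of the point itself. -/
theorem zero_mem_activeI_translateConfig_iff (v : Plane) (ψ : Set (Plane × ℝ)) :
    0 ∈ c.activeI (translateConfig (-v) ψ) ↔ v ∈ c.activeI ψ := by
  constructor
  · rintro ⟨_, ⟨⟨p, hp, rfl⟩, hn⟩, h0⟩
    rw [neighborsI_translateConfig, translateConfig,
      (translateConfig_injective _).encard_image] at hn
    exact ⟨p, ⟨hp, hn⟩, add_neg_eq_zero.1 h0⟩
  · rintro ⟨p, ⟨hp, hn⟩, rfl⟩
    refine ⟨_, ⟨⟨p, hp, rfl⟩, ?_⟩, add_neg_cancel _⟩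
    rwa [neighborsI_translateConfig, translateConfig, (translateConfig_injective _).encard_image]

theorem zero_mem_activeII_translateConfig_iff (v : Plane) (ψ : Set (Plane × ℝ × ℝ)) :
    0 ∈ c.activeII (translateConfig (-v) ψ) ↔ v ∈ c.activeII ψ := by
  constructor
  · rintro ⟨_, ⟨⟨p, hp, rfl⟩, hn⟩, h0⟩
    rw [neighborsII_translateConfig, translateConfig,
      (translateConfig_injective _).encard_image] at hn
    exact ⟨p, ⟨hp, hn⟩, add_neg_eq_zero.1 h0⟩
  · rintro ⟨p, ⟨hp, hn⟩, rfl⟩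
    refine ⟨_, ⟨⟨p, hp, rfl⟩, ?_⟩, add_neg_cancel _⟩
    rwa [neighborsII_translateConfig, translateConfig, (translateConfig_injective _).encard_image]

end RTSCTSConfig

/-! ### Type I thinning -/

namespace BipolarProcess

variable {Ω : Type*} [MeasurableSpace Ω] {P : Measure Ω} {l : ℝ} (X : BipolarProcess P l)
  (c : RTSCTSConfig)

/-- Injectivity enters twice: distinct indices give distinct marked points, and the location alone,
which is all that `activeI` keeps, determines the index. -/
theorem mem_activeI_config_iff {ω : Ω} (hω : Function.Injective fun i => X.y i ω) (i : ℕ) :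
    X.y i ω ∈ c.activeI (X.config ω) ↔ X.neighborIndices c i ω = ∅ := by
  have hn : c.neighborsI (X.config ω) (X.y i ω, X.θ i ω) = ∅ ↔ X.neighborIndices c i ω = ∅ := by
    simp only [Set.eq_empty_iff_forall_notMem]
    constructor
    · intro h j hj
      refine h (X.y j ω, X.θ j ω) ⟨⟨⟨j, rfl⟩, fun he => hj.1 (hω (congrArg Prod.fst he))⟩, ?_⟩
      exact (c.mem_exclusionRegion_receiver_iff _ _ _).2 hj.2
    · rintro h _ ⟨⟨⟨j, rfl⟩, hne⟩, hmem⟩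
      refine h j ⟨?_, (c.mem_exclusionRegion_receiver_iff _ _ _).1 hmem⟩
      rintro rfl
      exact hne rfl
  rw [← hn]
  constructor
  · rintro ⟨_, ⟨⟨j, rfl⟩, hj⟩, hji⟩
    obtain rfl := hω hji
    exact Set.encard_eq_zero.1 hj
  · intro h
    exact ⟨_, ⟨⟨i, rfl⟩, Set.encard_eq_zero.2 h⟩, rfl⟩

theorem activeI_config_eq {ω : Ω} (hω : Function.Injective fun i => X.y i ω) :
    c.activeI (X.config ω) = (fun i => X.y i ω) '' {i | X.neighborIndices c i ω = ∅} := by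
  ext z
  constructor
  · intro hz
    obtain ⟨_, ⟨⟨i, rfl⟩, _⟩, rfl⟩ := id hz
    exact ⟨i, (X.mem_activeI_config_iff c hω i).1 hz, rfl⟩
  · rintro ⟨i, hi, rfl⟩
    exact (X.mem_activeI_config_iff c hω i).2 hi

theorem measurable_encard_neighborIndices (i : ℕ) :
    Measurable fun ω => (X.neighborIndices c i ω).encard :=
  measurable_encard_of_measurableSet fun j =>
    ((X.measurable_θ i).prodMk (measurable_pi_iff.2 X.measurable_y))
      (measurableSet_mem_neighborIndices c i j)

theorem measurableSet_neighborIndices_eq_empty (i : ℕ) :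
    MeasurableSet {ω | X.neighborIndices c i ω = ∅} := by
  simp_rw [← Set.encard_eq_zero]
  exact X.measurable_encard_neighborIndices c i (measurableSet_singleton 0)

variable [IsProbabilityMeasure P]

theorem tsum_measure_activeI (hl : 0 ≤ l) {B : Set Plane} (hB : MeasurableSet B)
    (hv : volume B ≠ ∞) :
    ∑' i, P (X.y i ⁻¹' B ∩ {ω | X.neighborIndices c i ω = ∅})
      = ENNReal.ofReal l * ENNReal.ofReal (Real.exp (-(l * c.Vo))) * volume B := by
  classical
  -- With this `f` the Mecke formula yields the void probability of the exclusion region.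
  set f : ℕ∞ → ℝ≥0∞ := Set.indicator {0} fun _ => 1
  have hf : ∀ n, f n ≤ 1 := fun n => Set.indicator_le_self' (fun _ _ => zero_le) n
  have hA := (c.isCompact_regionAt 0)
  have hN := X.isPPPEnumeration.measurable_indexCount hA.isClosed.measurableSet
  have hlaw := X.isPPPEnumeration.isPoissonCount hA.isClosed.measurableSet hA.measure_lt_top.ne
  have hval : ∫⁻ ω, f (indexCount X.y (c.regionAt 0) ω) ∂P
      = ENNReal.ofReal (Real.exp (-(l * c.Vo))) := by
    have h1 : ∫⁻ ω, f (indexCount X.y (c.regionAt 0) ω) ∂P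
        = P {ω | indexCount X.y (c.regionAt 0) ω = (0 : ℕ)} := by
      rw [← lintegral_indicator_one (μ := P)
        (s := {ω | indexCount X.y (c.regionAt 0) ω = (0 : ℕ)}) (hN (measurableSet_singleton _))]
      rfl
    rw [h1, hlaw 0, c.volume_real_regionAt]
    simp
  rw [mul_right_comm, ← hval, ← X.mecke c hl hB hv hf]
  refine tsum_congr fun i => ?_
  rw [← lintegral_indicator_one
    ((X.measurable_y i hB).inter (X.measurableSet_neighborIndices_eq_empty c i))]
  refine lintegral_congr fun ω => ?_
  by_cases h1 : X.y i ω ∈ B <;> by_cases h2 : X.neighborIndices c i ω = ∅ <;>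
    simp [f, h1, h2]

theorem retentionProbI_eq (hl : 0 < l) :
    X.retentionProbI c = ENNReal.ofReal (Real.exp (-(l * c.Vo))) :=
  palmProb_of_index X.measurable_y (X.measurableSet_neighborIndices_eq_empty c) X.injective_y
    (S := {ψ | 0 ∈ c.activeI ψ})
    (fun _ hω i => (c.zero_mem_activeI_translateConfig_iff _ _).trans
      (X.mem_activeI_config_iff c hω i)) hl
    fun _ hB hv => X.tsum_measure_activeI c hl.le hB hv

theorem nodeIntensityI_eq (hl : 0 < l) :
    X.nodeIntensityI c = l * Real.exp (-(l * c.Vo)) := by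
  rw [nodeIntensityI, X.retentionProbI_eq c hl, ENNReal.toReal_ofReal (Real.exp_pos _).le]

theorem hasIntensity_activeI (hl : 0 < l) :
    HasIntensity P (fun ω => c.activeI (X.config ω)) (X.nodeIntensityI c) := by
  refine hasIntensity_of_index X.measurable_y (X.measurableSet_neighborIndices_eq_empty c)
    X.injective_y (fun ω hω => X.activeI_config_eq c hω) fun B hB hv => ?_
  rw [X.nodeIntensityI_eq c hl, ENNReal.ofReal_mul hl.le]
  exact X.tsum_measure_activeI c hl.le hB hv

end BipolarProcess

/-! ### Type II thinning -/

namespace TimedBipolarProcess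

variable {Ω : Type*} [MeasurableSpace Ω] {P : Measure Ω} {l : ℝ} (X : TimedBipolarProcess P l)
  (c : RTSCTSConfig)

/-- The event that the `i`th transmitter has the smallest time mark in its neighborhood. -/
def firstInNeighborhood (i : ℕ) : Set Ω :=
  {ω | ∀ j ∈ X.neighborIndices c i ω, X.t i ω ≤ X.t j ω}

theorem mem_activeII_timedConfig_iff {ω : Ω} (hω : Function.Injective fun i => X.y i ω) (i : ℕ) :
    X.y i ω ∈ c.activeII (X.timedConfig ω) ↔ ω ∈ X.firstInNeighborhood c i := by
  have hn : c.neighborsII (X.timedConfig ω) (X.y i ω, X.θ i ω, X.t i ω) = ∅ ↔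
      ω ∈ X.firstInNeighborhood c i := by
    simp only [Set.eq_empty_iff_forall_notMem]
    constructor
    · intro h j hj
      by_contra ht
      refine h (X.y j ω, X.θ j ω, X.t j ω)
        ⟨⟨⟨j, rfl⟩, fun he => hj.1 (hω (congrArg Prod.fst he))⟩, ?_, not_le.1 ht⟩
      exact (c.mem_exclusionRegion_receiver_iff _ _ _).2 hj.2
    · rintro h _ ⟨⟨⟨j, rfl⟩, hne⟩, hmem, ht⟩
      refine not_lt.2 (h j ⟨?_, (c.mem_exclusionRegion_receiver_iff _ _ _).1 hmem⟩) ht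
      rintro rfl
      exact hne rfl
  rw [← hn]
  constructor
  · rintro ⟨_, ⟨⟨j, rfl⟩, hj⟩, hji⟩
    obtain rfl := hω hji
    exact Set.encard_eq_zero.1 hj
  · intro h
    exact ⟨_, ⟨⟨i, rfl⟩, Set.encard_eq_zero.2 h⟩, rfl⟩

theorem activeII_timedConfig_eq {ω : Ω} (hω : Function.Injective fun i => X.y i ω) :
    c.activeII (X.timedConfig ω) = (fun i => X.y i ω) '' {i | ω ∈ X.firstInNeighborhood c i} := by
  ext z
  constructor
  · intro hz
    obtain ⟨_, ⟨⟨i, rfl⟩, _⟩, rfl⟩ := id hz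
    exact ⟨i, (X.mem_activeII_timedConfig_iff c hω i).1 hz, rfl⟩
  · rintro ⟨i, hi, rfl⟩
    exact (X.mem_activeII_timedConfig_iff c hω i).2 hi

theorem measurableSet_mark_le (i : ℕ) :
    MeasurableSet {p : ((ℕ → Plane) × (ℕ → ℝ)) × (ℕ → ℝ) |
      ∀ j, (j ≠ i ∧ p.1.1 j - p.1.1 i ∈ c.regionAt (p.1.2 i)) → p.2 i ≤ p.2 j} := by
  rw [Set.ofPred_forall]
  refine MeasurableSet.iInter fun j => ?_
  have h1 : Measurable fun p : ((ℕ → Plane) × (ℕ → ℝ)) × (ℕ → ℝ) => (p.1.2 i, p.1.1) :=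
    ((measurable_pi_apply i).comp (measurable_snd.comp measurable_fst)).prodMk
      (measurable_fst.comp measurable_fst)
  exact MeasurableSet.imp (h1 (BipolarProcess.measurableSet_mem_neighborIndices c i j))
    (measurableSet_le ((measurable_pi_apply i).comp measurable_snd)
      ((measurable_pi_apply j).comp measurable_snd))

theorem measurable_marks : Measurable fun ω => (fun i => X.y i ω, fun i => X.θ i ω) :=
  (measurable_pi_iff.2 X.measurable_y).prodMk (measurable_pi_iff.2 X.measurable_θ)

theorem measurableSet_firstInNeighborhood (i : ℕ) :
    MeasurableSet (X.firstInNeighborhood c i) :=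
  (X.measurable_marks.prodMk (measurable_pi_iff.2 X.measurable_t)) (measurableSet_mark_le c i)

variable [IsProbabilityMeasure P]

/-- The time marks are independent of points and orientations. Conditionally on the latter, the
neighbors form a fixed finite set that does not contain `i`, and `measure_forall_le_of_uniform`
gives the chance that `i` comes first. -/
theorem measure_firstInNeighborhood (hl : 0 ≤ l) {B : Set Plane} (hB : MeasurableSet B) (i : ℕ) :
    P (X.y i ⁻¹' B ∩ X.firstInNeighborhood c i)
      = ∫⁻ ω, B.indicator (fun _ => 1) (X.y i ω) *
          (((X.neighborIndices c i ω).encard : ℝ≥0∞) + 1)⁻¹ ∂P := by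
  classical
  set G : (ℕ → Plane) × (ℕ → ℝ) → (ℕ → ℝ) → ℝ≥0∞ := fun u t =>
    B.indicator (fun _ => 1) (u.1 i) * {p : ((ℕ → Plane) × (ℕ → ℝ)) × (ℕ → ℝ) |
      ∀ j, (j ≠ i ∧ p.1.1 j - p.1.1 i ∈ c.regionAt (p.1.2 i)) → p.2 i ≤ p.2 j}.indicator
      (fun _ => 1) (u, t) with hGdef
  have hG : Measurable (Function.uncurry G) :=
    ((measurable_const.indicator hB).comp ((measurable_pi_apply i).comp
      (measurable_fst.comp measurable_fst))).mul
      (measurable_const.indicator (measurableSet_mark_le c i))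
  have hmt : Measurable fun ω i => X.t i ω := measurable_pi_iff.2 X.measurable_t
  rw [← lintegral_indicator_one
    ((X.measurable_y i hB).inter (X.measurableSet_firstInNeighborhood c i))]
  have h1 : ∀ ω, (X.y i ⁻¹' B ∩ X.firstInNeighborhood c i).indicator 1 ω
      = G (fun i => X.y i ω, fun i => X.θ i ω) (fun i => X.t i ω) := by
    intro ω
    have h2 : ω ∈ X.firstInNeighborhood c i ↔
        ∀ j, (j ≠ i ∧ X.y j ω - X.y i ω ∈ c.regionAt (X.θ i ω)) → X.t i ω ≤ X.t j ω := Iff.rfl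
    simp only [hGdef, Set.indicator_apply, Set.mem_inter_iff, Set.mem_preimage, Pi.one_apply,
      Set.mem_ofPred_eq, h2, ite_and, mul_ite, mul_one, mul_zero]
    split_ifs <;> rfl
  simp_rw [h1]
  rw [X.indep_yθ_t.lintegral_comp_eq X.measurable_marks hmt hG]
  refine lintegral_congr_ae ?_
  filter_upwards [X.ae_neighborIndices_finite c hl] with ω hω
  -- From here `ω` is frozen and only the marks, taken at `ω'`, are random.
  have h3 : ∀ t : ℕ → ℝ, G (fun i => X.y i ω, fun i => X.θ i ω) t
      = B.indicator (fun _ => 1) (X.y i ω) *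
        {t : ℕ → ℝ | ∀ j ∈ (hω i).toFinset, t i ≤ t j}.indicator (fun _ => 1) t := by
    intro t
    simp only [hGdef]
    congr 1
    simp only [Set.indicator_apply, Set.mem_ofPred_eq, Set.Finite.mem_toFinset]
    rfl
  simp_rw [h3]
  have hS : MeasurableSet {ω' | ∀ j ∈ (hω i).toFinset, X.t i ω' ≤ X.t j ω'} := by
    simp_rw [Set.ofPred_forall]
    exact MeasurableSet.iInter fun j => MeasurableSet.iInter fun _ =>
      measurableSet_le (X.measurable_t i) (X.measurable_t j)
  have h4 : ∫⁻ ω', {t : ℕ → ℝ | ∀ j ∈ (hω i).toFinset, t i ≤ t j}.indicator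
      (fun _ => (1 : ℝ≥0∞)) (fun j => X.t j ω') ∂P
      = P {ω' | ∀ j ∈ (hω i).toFinset, X.t i ω' ≤ X.t j ω'} := by
    rw [← lintegral_indicator_one hS]
    rfl
  have hi : i ∉ (hω i).toFinset := by
    rw [Set.Finite.mem_toFinset]
    exact fun h => h.1 rfl
  have hb : B.indicator (fun _ => (1 : ℝ≥0∞)) (X.y i ω) ≠ ∞ :=
    ne_top_of_le_ne_top ENNReal.one_ne_top
      (Set.indicator_le_self' (f := fun _ => (1 : ℝ≥0∞)) (fun _ _ => zero_le) (X.y i ω))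
  rw [lintegral_const_mul' _ _ hb, h4,
    measure_forall_le_of_uniform X.measurable_t X.uniform_t X.iIndep_t hi,
    (hω i).encard_eq_coe_toFinset_card, ENat.toENNReal_coe]

theorem tsum_measure_activeII (hl : 0 < l) {B : Set Plane} (hB : MeasurableSet B)
    (hv : volume B ≠ ∞) :
    ∑' i, P (X.y i ⁻¹' B ∩ X.firstInNeighborhood c i)
      = ENNReal.ofReal l * ENNReal.ofReal ((1 - Real.exp (-(l * c.Vo))) / (l * c.Vo)) *
        volume B := by
  have hA := (c.isCompact_regionAt 0)
  have hN := X.isPPPEnumeration.measurable_indexCount hA.isClosed.measurableSet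
  have hlaw := X.isPPPEnumeration.isPoissonCount hA.isClosed.measurableSet hA.measure_lt_top.ne
  rw [c.volume_real_regionAt] at hlaw
  simp_rw [X.measure_firstInNeighborhood c hl.le hB]
  rw [X.mecke c hl.le hB hv (f := fun n => ((n : ℝ≥0∞) + 1)⁻¹)
    fun n => ENNReal.inv_le_one.2 le_add_self,
    hlaw.lintegral_inv_add_one hN (mul_pos hl c.Vo_pos), mul_right_comm]

theorem retentionProbII_eq (hl : 0 < l) : X.retentionProbII c
    = ENNReal.ofReal ((1 - Real.exp (-(l * c.Vo))) / (l * c.Vo)) :=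
  palmProb_of_index X.measurable_y (X.measurableSet_firstInNeighborhood c) X.injective_y
    (S := {ψ | 0 ∈ c.activeII ψ})
    (fun _ hω i => (c.zero_mem_activeII_translateConfig_iff _ _).trans
      (X.mem_activeII_timedConfig_iff c hω i)) hl
    fun _ hB hv => X.tsum_measure_activeII c hl hB hv

theorem nodeIntensityII_eq (hl : 0 < l) :
    X.nodeIntensityII c = (1 - Real.exp (-(l * c.Vo))) / c.Vo := by
  have hV := c.Vo_pos
  have h1 : Real.exp (-(l * c.Vo)) ≤ 1 := Real.exp_le_one_iff.2 (by nlinarith [mul_pos hl hV])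
  rw [nodeIntensityII, X.retentionProbII_eq c hl,
    ENNReal.toReal_ofReal (div_nonneg (sub_nonneg.2 h1) (mul_pos hl hV).le)]
  field_simp

theorem hasIntensity_activeII (hl : 0 < l) :
    HasIntensity P (fun ω => c.activeII (X.timedConfig ω)) (X.nodeIntensityII c) := by
  refine hasIntensity_of_index X.measurable_y (X.measurableSet_firstInNeighborhood c)
    X.injective_y (fun ω hω => X.activeII_timedConfig_eq c hω) fun B hB hv => ?_
  have hV := c.Vo_pos
  rw [X.tsum_measure_activeII c hl hB hv, X.nodeIntensityII_eq c hl, ← ENNReal.ofReal_mul hl.le]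
  congr 2
  field_simp

end TimedBipolarProcess

/-! ### The intensities as functions of the intensity of all transmitters -/

theorem integral_exp_neg_mul {l V : ℝ} (hl : l ≠ 0) (hV : V ≠ 0) :
    ∫ t in (0 : ℝ)..1, Real.exp (-(l * t * V)) = (1 - Real.exp (-(l * V))) / (l * V) := by
  have hlV : -(l * V) ≠ 0 := neg_ne_zero.2 (mul_ne_zero hl hV)
  have h1 : ∀ t : ℝ, Real.exp (-(l * t * V)) = Real.exp (-(l * V) * t) := fun t => by ring_nf
  simp_rw [h1]
  rw [intervalIntegral.integral_comp_mul_left (fun x => Real.exp x) hlV, integral_exp]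
  simp only [mul_one, mul_zero, Real.exp_zero, smul_eq_mul]
  field_simp
  ring

theorem hasDerivAt_mul_exp_neg_mul (V l : ℝ) :
    HasDerivAt (fun l => l * Real.exp (-(l * V))) ((1 - l * V) * Real.exp (-(l * V))) l := by
  have h1 : HasDerivAt (fun l : ℝ => -(l * V)) (-V) l := by
    convert! ((hasDerivAt_id l).mul_const V).neg using 1
    rw [one_mul]
  convert! (hasDerivAt_id l).mul h1.exp using 1
  simp only [id]
  ring

theorem strictMonoOn_mul_exp_neg_mul {V : ℝ} (hV : 0 < V) :
    StrictMonoOn (fun l => l * Real.exp (-(l * V))) (Set.Iic (1 / V)) := by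
  refine strictMonoOn_of_deriv_pos (convex_Iic _)
    (fun l _ => (hasDerivAt_mul_exp_neg_mul V l).continuousAt.continuousWithinAt) fun l hl => ?_
  rw [interior_Iic, Set.mem_Iio, lt_div_iff₀ hV] at hl
  rw [(hasDerivAt_mul_exp_neg_mul V l).deriv]
  exact mul_pos (sub_pos.2 hl) (Real.exp_pos _)

theorem strictAntiOn_mul_exp_neg_mul {V : ℝ} (hV : 0 < V) :
    StrictAntiOn (fun l => l * Real.exp (-(l * V))) (Set.Ici (1 / V)) := by
  refine strictAntiOn_of_deriv_neg (convex_Ici _)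
    (fun l _ => (hasDerivAt_mul_exp_neg_mul V l).continuousAt.continuousWithinAt) fun l hl => ?_
  rw [interior_Ici, Set.mem_Ioi, div_lt_iff₀ hV] at hl
  rw [(hasDerivAt_mul_exp_neg_mul V l).deriv]
  exact mul_neg_of_neg_of_pos (sub_neg.2 hl) (Real.exp_pos _)

theorem mainTheorem5 (c : RTSCTSConfig) :
    -- the area of the exclusion region is finite and positive
    volume (c.exclusionRegion 0 !₂[c.d, 0]) ≠ ∞ ∧ 0 < c.Vo ∧
    -- Type I thinning
    (∀ (l : ℝ), 0 < l → ∀ (Ω : Type*) [MeasurableSpace Ω] (P : Measure Ω) [IsProbabilityMeasure P]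
      (X : BipolarProcess P l),
      HasIntensity P (fun ω => c.activeI (X.config ω)) (X.nodeIntensityI c) ∧
      X.retentionProbI c = ENNReal.ofReal (Real.exp (-(l * c.Vo))) ∧
      X.nodeIntensityI c = l * Real.exp (-(l * c.Vo))) ∧
    -- Type II thinning
    (∀ (l : ℝ), 0 < l → ∀ (Ω : Type*) [MeasurableSpace Ω] (P : Measure Ω) [IsProbabilityMeasure P]
      (X : TimedBipolarProcess P l),
      HasIntensity P (fun ω => c.activeII (X.timedConfig ω)) (X.nodeIntensityII c) ∧
      X.retentionProbII c = ENNReal.ofReal (∫ t in (0 : ℝ)..1, Real.exp (-(l * t * c.Vo))) ∧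
      X.nodeIntensityII c = l * ∫ t in (0 : ℝ)..1, Real.exp (-(l * t * c.Vo)) ∧
      X.nodeIntensityII c = (1 - Real.exp (-(l * c.Vo))) / c.Vo) ∧
    -- Type I as a function of the intensity of all transmitters: unique maximum at `1 / V_o`
    (∀ (Ω : Set.Ioi (0 : ℝ) → Type*) [∀ l, MeasurableSpace (Ω l)] (P : ∀ l, Measure (Ω l))
      [∀ l, IsProbabilityMeasure (P l)] (X : ∀ l, BipolarProcess (P l) (l : ℝ)),
      (∀ l m : Set.Ioi (0 : ℝ), (m : ℝ) = 1 / c.Vo → l ≠ m →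
        (X l).nodeIntensityI c < (X m).nodeIntensityI c) ∧
      (∀ m : Set.Ioi (0 : ℝ), (m : ℝ) = 1 / c.Vo →
        (X m).nodeIntensityI c = 1 / c.Vo * Real.exp (-1)) ∧
      StrictMonoOn (fun l => (X l).nodeIntensityI c) {l | (l : ℝ) ≤ 1 / c.Vo} ∧
      StrictAntiOn (fun l => (X l).nodeIntensityI c) {l | 1 / c.Vo ≤ (l : ℝ)}) ∧
    -- Type II as a function of the intensity of all transmitters: increasing to `1 / V_o`
    (∀ (Ω : Set.Ioi (0 : ℝ) → Type*) [∀ l, MeasurableSpace (Ω l)] (P : ∀ l, Measure (Ω l))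
      [∀ l, IsProbabilityMeasure (P l)] (X : ∀ l, TimedBipolarProcess (P l) (l : ℝ)),
      StrictMono (fun l => (X l).nodeIntensityII c) ∧
      Tendsto (fun l => (X l).nodeIntensityII c) atTop (𝓝 (1 / c.Vo))) := by
  have hV := c.Vo_pos
  refine ⟨c.volume_exclusionRegion_ne_top, hV, ?_, ?_, ?_, ?_⟩
  · intro l hl Ω _ P _ X
    exact ⟨X.hasIntensity_activeI c hl, X.retentionProbI_eq c hl, X.nodeIntensityI_eq c hl⟩
  · intro l hl Ω _ P _ X
    -- In closed form the integral over the time mark is the mean of `1 / (N + 1)` found for the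
    -- retention probability.
    rw [integral_exp_neg_mul hl.ne' hV.ne']
    refine ⟨X.hasIntensity_activeII c hl, X.retentionProbII_eq c hl, ?_,
      X.nodeIntensityII_eq c hl⟩
    rw [X.nodeIntensityII_eq c hl]
    field_simp
  · intro Ω _ P _ X
    simp only [fun l : Set.Ioi (0 : ℝ) => (X l).nodeIntensityI_eq c l.2]
    have hmono : StrictMonoOn (fun l : Set.Ioi (0 : ℝ) => (l : ℝ) * Real.exp (-(l * c.Vo)))
        {l | (l : ℝ) ≤ 1 / c.Vo} := fun a ha b hb hab =>
      strictMonoOn_mul_exp_neg_mul hV ha hb hab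
    have hanti : StrictAntiOn (fun l : Set.Ioi (0 : ℝ) => (l : ℝ) * Real.exp (-(l * c.Vo)))
        {l | 1 / c.Vo ≤ (l : ℝ)} := fun a ha b hb hab =>
      strictAntiOn_mul_exp_neg_mul hV ha hb hab
    refine ⟨fun l m hm hne => ?_, fun m hm => ?_, hmono, hanti⟩
    -- The point `1 / V_o` belongs to both monotonicity ranges, so each side gives a strict
    -- comparison with it.
    · rcases lt_or_gt_of_ne hne with h | h
      · exact hmono (le_trans (Subtype.coe_le_coe.2 h.le) hm.le) hm.le h
      · exact hanti hm.ge (le_trans hm.ge (Subtype.coe_le_coe.2 h.le)) h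
    · rw [hm, one_div_mul_cancel hV.ne']
  · intro Ω _ P _ X
    simp only [fun l : Set.Ioi (0 : ℝ) => (X l).nodeIntensityII_eq c l.2]
    refine ⟨fun a b hab => ?_, ?_⟩
    · have hab' : (a : ℝ) < b := hab
      refine div_lt_div_of_pos_right (sub_lt_sub_left (Real.exp_lt_exp.2 ?_) 1) hV
      exact neg_lt_neg (mul_lt_mul_of_pos_right hab' hV)
    · have h1 : Tendsto (fun l : Set.Ioi (0 : ℝ) => (l : ℝ) * c.Vo) atTop atTop :=
        (tendsto_comp_val_Ioi_atTop.2 tendsto_id).atTop_mul_const hV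
      have h2 := Real.tendsto_exp_neg_atTop_nhds_zero.comp h1
      simpa using (h2.const_sub 1).div_const c.Vo
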